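/- Let $n\ge 3$, let $m,b,J_1,J_n>0$ and $\ell,\mathcal G\in\mathbb R$, and consider the $n$-dimensional rubber Routh sphere: an axisymmetric sphere of mass $m$ and radius $b$, whose centre of mass and geometric centre are $\ell$ apart along the symmetry axis $E_n$ ($\ell$ may be signed), rolling without slipping or spinning on a horizontal hyperplane in $\mathbb R^n$. Precisely, it is the nonholonomic system $(Q,D,L)$ given as follows. - The configuration space is $Q=\{(R,x)\in SO(n)\times\mathbb R^n : x_n=b\}\cong SO(n)\times\mathbb R^{n-1}$. For a tangent vector $(\dot R,\dot x)$ put $\omega=\dot RR^{-1}$ and $\Omega=R^{-1}\dot R$, and let $\gamma=R^{-1}e_n$. - The constraint distribution $D\subset TQ$ is given by $\dot x=b\,\omega e_n$ (no slipping) and $\omega_{ij}=0$ for all $1\le i,j\le n-1$ (no spinning). - The Lagrangian is $L=\tfrac12(\mathbb I\Omega,\Omega)_\kappa+\tfrac m2\|R^{-1}\dot x+\ell\,\Omega E_n\|^2-m\mathcal G\ell\gamma_n$, where $\mathbb I\Omega=\mathbb J\Omega+\Omega\mathbb J$, $\mathbb J=\mathrm{diag}(J_1,\dots,J_1,J_n)$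 and $(\xi,\eta)_\kappa=-\tfrac12\operatorname{tr}(\xi\eta)$. Its kinetic energy defines the kinetic energy metric on $Q$. Let $SE(n-1)$ be the group of pairs $(h,y)$ with $h\in SO(n)$, $he_n=e_n$, $y\in\mathbb R^n$, $y_n=0$, acting on $Q$ by $(h,y)\cdot(R,x)=(hR,hx+y)$. **Theorem.** $(Q,D,L)$ is a $\phi$-simple Chaplygin system with symmetry group $SE(n-1)$, shape space $S=Q/SE(n-1)=S^{n-1}=\{\gamma\in\mathbb R^n:\|\gamma\|=1\}$, orbit projection $\pi(R,x)=\gamma=R^{-1}e_n$, and $\phi\in C^\infty(S^{n-1})$ given by $$\phi(\gamma)=-\tfrac12\ln\!\big(2J_1+(J_n-J_1)\gamma_n^2+m(b+\ell\gamma_n)^2\big).$$ This means the following. - *Nonholonomic system.* $D$ is a non-integrable smooth distribution of constant rank $r=n-1\ge2$, the kinetic energy metric is Riemannian, and the potential energy is smooth. - *Chaplygin system.* The $(\dim Q-r)$-dimensional Lie group $G=SE(n-1)$ acts smoothly, freely and properly on $Q$, by isometries of the kinetic energy metric, leaving the potential energy and $D$ invariant, and $T_qQ=\mathfrak g\cdot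 q\oplus D_q$ for all $q\in Q$. - *Shape space.* $\pi:Q\to S^{n-1}$ is a smooth surjective submersion whose fibres are exactly the $G$-orbits. - *$\phi$-simplicity.* The gyroscopic tensor $$\mathcal T(Y,Z)(s)=T_q\pi\big(\mathcal P[\mathrm{hor}(Y),\mathrm{hor}(Z)](q)\big)-[Y,Z](s),\qquad q\in\pi^{-1}(s),$$ satisfies $\mathcal T(Y,Z)=Z[\phi]\,Y-Y[\phi]\,Z$ for all smooth vector fields $Y,Z$ on $S^{n-1}$ (whichever $q\in\pi^{-1}(s)$ is used). Here $\mathrm{hor}(Y)$ is the vector field on $Q$ with values in $D$ that is $\pi$-related to $Y$, and $\mathcal P:TQ\to D$ is the orthogonal projection for the kinetic energy metric. In particular, for $n=3$, let $I_1,I_3$ be the principal moments of inertia, that is $\mathbb I(E_2\wedge E_3)=I_1\,E_2\wedge E_3$ and $\mathbb I(E_1\wedge E_2)=I_3\,E_1\wedge E_2$, where $E_i\wedge E_j=E_iE_j^t-E_jE_i^t$. Then the same holds with $$\phi(\gamma)=-\tfrac12\ln\!\big(I_1\gamma_3^2+I_3(1-\gamma_3^2)+m(b+\ell\gamma_3)^2\big).$$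 -/

import Mathlib

open scoped ContDiff Matrix Topology Matrix.Norms.Operator

section Submanifolds

variable {E : Type*} [NormedAddCommGroup E] [NormedSpace ℝ E]

/-- `M` is a smooth embedded submanifold (of some fixed codimension `k`) of the
finite-dimensional space `E`: near each of its points it is the zero set of a smooth map to `ℝᵏ`
that is a submersion along `M`. -/
def IsEmbeddedSubmanifold (M : Set E) : Prop :=
  ∃ k : ℕ, ∀ p ∈ M, ∃ (U : Set E) (f : E → (Fin k → ℝ)),
    IsOpen U ∧ p ∈ U ∧ ContDiffOn ℝ ∞ f U ∧
    (∀ x ∈ U, x ∈ M ↔ f x = 0) ∧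
    (∀ x ∈ U ∩ M, Function.Surjective (fderiv ℝ f x))

/-- The tangent space `T_p M` of an embedded submanifold, as a subspace of the ambient space.
(For an embedded submanifold the tangent cone is already a linear subspace.) A derivative
`fderivWithin ℝ f M p` of a map on `M` is uniquely determined on this subspace, where it is the
tangent map `T_p f`; on vector fields tangent to `M`, `VectorField.lieBracketWithin ℝ X Y M` is
therefore the Jacobi-Lie bracket on `M`. -/
def tangentSpaceAt (M : Set E) (p : E) : Submodule ℝ E :=
  Submodule.span ℝ (tangentConeAt ℝ M p)

/-- `X` (restricted to `M`) is a smooth vector field on the embedded submanifold `M`. -/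
structure IsSmoothVectorField (M : Set E) (X : E → E) : Prop where
  smooth : ContDiffOn ℝ ∞ X M
  tangent : ∀ p ∈ M, X p ∈ tangentSpaceAt M p

end Submanifolds

section Nonholonomic

/-- The data `(Q, D, L)` of a nonholonomic system whose configuration space `Q` is embedded in `E`:
the constraint distribution `D`, the kinetic energy metric and the potential energy.
Only the values at points of `Q` and on vectors tangent to `Q` matter. -/
structure NonholonomicData (E : Type*) [NormedAddCommGroup E] [NormedSpace ℝ E] where
  Q : Set E
  D : E → Submodule ℝ E
  metric : E → LinearMap.BilinForm ℝ E
  potential : E → ℝ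

variable {E : Type*} [NormedAddCommGroup E] [NormedSpace ℝ E]
variable {F : Type*} [NormedAddCommGroup F] [NormedSpace ℝ F]

/-- The Lagrangian `L = K - U`, where the kinetic energy is `K(v) = ⟪v, v⟫ / 2`. -/
noncomputable def NonholonomicData.lagrangian (N : NonholonomicData E) (q v : E) : ℝ :=
  (1 / 2) * N.metric q v v - N.potential q

/-- The data form a nonholonomic system with constraint distribution of rank `r`. -/
structure IsNonholonomicSystem (N : NonholonomicData E) (r : ℕ) : Prop where
  submanifold : IsEmbeddedSubmanifold N.Q
  rank_ge : 2 ≤ r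
  le_tangent : ∀ q ∈ N.Q, N.D q ≤ tangentSpaceAt N.Q q
  rank_eq : ∀ q ∈ N.Q, Module.finrank ℝ (N.D q) = r
  /-- Together with the constancy of the rank: `D` is a smooth vector subbundle of `TQ`. -/
  smooth_distribution : ∀ q ∈ N.Q, ∃ U : Set E, IsOpen U ∧ q ∈ U ∧
    ∃ (k : ℕ) (X : Fin k → E → E), (∀ i, ContDiffOn ℝ ∞ (X i) (N.Q ∩ U)) ∧
      ∀ p ∈ N.Q ∩ U, N.D p = Submodule.span ℝ (Set.range fun i => X i p)
  /-- The distribution `D` is not integrable (it is not involutive). -/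
  nonintegrable : ∃ X Y : E → E, IsSmoothVectorField N.Q X ∧ IsSmoothVectorField N.Q Y ∧
    (∀ q ∈ N.Q, X q ∈ N.D q ∧ Y q ∈ N.D q) ∧
    ∃ q ∈ N.Q, VectorField.lieBracketWithin ℝ X Y N.Q q ∉ N.D q
  metric_symm : ∀ q ∈ N.Q, ∀ v ∈ tangentSpaceAt N.Q q, ∀ w ∈ tangentSpaceAt N.Q q,
    N.metric q v w = N.metric q w v
  metric_pos : ∀ q ∈ N.Q, ∀ v ∈ tangentSpaceAt N.Q q, v ≠ 0 → 0 < N.metric q v v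
  metric_smooth : ContDiffOn ℝ ∞ (fun p : E × E × E => N.metric p.1 p.2.1 p.2.2)
    {p | p.1 ∈ N.Q ∧ p.2.1 ∈ tangentSpaceAt N.Q p.1 ∧ p.2.2 ∈ tangentSpaceAt N.Q p.1}
  potential_smooth : ContDiffOn ℝ ∞ N.potential N.Q

variable {ι : Type*} [Fintype ι] [DecidableEq ι]

/-- The matrices that belong to a subgroup of `GL(ι, ℝ)`. -/
def matrixSet (G : Subgroup (GL ι ℝ)) : Set (Matrix ι ι ℝ) :=
  {M | ∃ g ∈ G, (g : Matrix ι ι ℝ) = M}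

/-- `act` restricts to a smooth, free and proper (left) action on `Q` of the matrix Lie group
`G`. -/
structure IsFreeProperSmoothAction (G : Subgroup (GL ι ℝ)) (act : Matrix ι ι ℝ → E → E)
    (Q : Set E) : Prop where
  closed_subgroup : IsClosed (G : Set (GL ι ℝ))
  mapsTo : ∀ g ∈ matrixSet G, ∀ q ∈ Q, act g q ∈ Q
  one_act : ∀ q ∈ Q, act 1 q = q
  mul_act : ∀ g ∈ matrixSet G, ∀ h ∈ matrixSet G, ∀ q ∈ Q, act (g * h) q = act g (act h q)
  smooth : ContDiffOn ℝ ∞ (fun p : Matrix ι ι ℝ × E => act p.1 p.2) (matrixSet G ×ˢ Q)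
  free : ∀ g ∈ matrixSet G, ∀ q ∈ Q, act g q = q → g = 1
  proper : ∀ K ⊆ Q, IsCompact K → IsCompact {g ∈ matrixSet G | ∃ q ∈ K, act g q ∈ K}

/-- The tangent space `𝔤 · q` at `q` to the orbit through `q`: the values at `q` of the
infinitesimal generators of the Lie algebra `𝔤 = T_1 G`. -/
noncomputable def orbitTangent (G : Subgroup (GL ι ℝ)) (act : Matrix ι ι ℝ → E → E) (q : E) :
    Submodule ℝ E :=
  (tangentSpaceAt (matrixSet G) 1).map
    (fderivWithin ℝ (fun g => act g q) (matrixSet G) 1 : Matrix ι ι ℝ →ₗ[ℝ] E)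

/-- The nonholonomic system `N` (with distribution of rank `r`) is a Chaplygin system with symmetry
group `G`. -/
structure IsChaplyginSystem (N : NonholonomicData E) (r : ℕ) (G : Subgroup (GL ι ℝ))
    (act : Matrix ι ι ℝ → E → E) : Prop where
  nonholonomic : IsNonholonomicSystem N r
  action : IsFreeProperSmoothAction G act N.Q
  dim_group : ∀ q ∈ N.Q, Module.finrank ℝ (tangentSpaceAt (matrixSet G) 1) + r =
    Module.finrank ℝ (tangentSpaceAt N.Q q)
  isometry : ∀ g ∈ matrixSet G, ∀ q ∈ N.Q,
    ∀ v ∈ tangentSpaceAt N.Q q, ∀ w ∈ tangentSpaceAt N.Q q,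
      N.metric (act g q) (fderivWithin ℝ (act g) N.Q q v) (fderivWithin ℝ (act g) N.Q q w) =
        N.metric q v w
  potential_invariant : ∀ g ∈ matrixSet G, ∀ q ∈ N.Q, N.potential (act g q) = N.potential q
  distribution_invariant : ∀ g ∈ matrixSet G, ∀ q ∈ N.Q,
    N.D (act g q) = (N.D q).map (fderivWithin ℝ (act g) N.Q q : E →ₗ[ℝ] E)
  splitting_sup : ∀ q ∈ N.Q, orbitTangent G act q ⊔ N.D q = tangentSpaceAt N.Q q
  splitting_inf : ∀ q ∈ N.Q, orbitTangent G act q ⊓ N.D q = ⊥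

/-- The embedded submanifold `S` of `F`, with the projection `π`, is the orbit space `Q / G`:
`π` is a smooth surjective submersion from `Q` to `S` whose fibres are the `G`-orbits. -/
structure IsOrbitSpace (Q : Set E) (G : Subgroup (GL ι ℝ)) (act : Matrix ι ι ℝ → E → E)
    (S : Set F) (π : E → F) : Prop where
  submanifold : IsEmbeddedSubmanifold S
  smooth : ContDiffOn ℝ ∞ π Q
  image_eq : π '' Q = S
  submersion : ∀ q ∈ Q, (tangentSpaceAt Q q).map (fderivWithin ℝ π Q q : E →ₗ[ℝ] F) =
    tangentSpaceAt S (π q)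
  fibres : ∀ q ∈ Q, ∀ p ∈ Q, π p = π q ↔ ∃ g ∈ matrixSet G, act g q = p

/-- The horizontal lift to `q` of a vector `v` tangent to the shape space at `π q`: the element of
`D_q` that `T_q π` maps to `v`. -/
noncomputable def horizontalLift (N : NonholonomicData E) (π : E → F) (q : E) (v : F) : E :=
  Classical.epsilon fun w => w ∈ N.D q ∧ fderivWithin ℝ π N.Q q w = v

/-- The horizontal lift `hor(Y)` of a vector field `Y` on the shape space. -/
noncomputable def horizontalLiftField (N : NonholonomicData E) (π : E → F) (Y : F → F) : E → E :=
  fun q => horizontalLift N π q (Y (π q))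

/-- The projection `T_q Q → D_q` that is orthogonal for the kinetic energy metric. -/
noncomputable def metricProjection (N : NonholonomicData E) (q v : E) : E :=
  Classical.epsilon fun u => u ∈ N.D q ∧ ∀ w ∈ N.D q, N.metric q (v - u) w = 0

/-- The value `𝒯(Y, Z)(π q)` of the gyroscopic tensor, computed at the point `q` of the fibre:
`T_q π (𝒫 [hor Y, hor Z] (q)) - [Y, Z](π q)`. -/
noncomputable def gyroscopicTensor (N : NonholonomicData E) (S : Set F) (π : E → F)
    (Y Z : F → F) (q : E) : F :=
  fderivWithin ℝ π N.Q q (metricProjection N q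
      (VectorField.lieBracketWithin ℝ (horizontalLiftField N π Y) (horizontalLiftField N π Z)
        N.Q q))
    - VectorField.lieBracketWithin ℝ Y Z S (π q)

/-- The nonholonomic system `N` is a `φ`-simple Chaplygin system, with symmetry group `G`, shape
space `S` of dimension `r`, orbit projection `π`, and the given function `φ : S → ℝ`:
`𝒯(Y, Z) = Z[φ] Y - Y[φ] Z` for all vector fields `Y, Z` on `S` (whichever point `q` of the fibre
is used to compute the left-hand side). -/
structure IsPhiSimpleChaplygin (N : NonholonomicData E) (r : ℕ) (G : Subgroup (GL ι ℝ))
    (act : Matrix ι ι ℝ → E → E) (S : Set F) (π : E → F) (φ : F → ℝ) : Prop where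
  chaplygin : IsChaplyginSystem N r G act
  shape_space : IsOrbitSpace N.Q G act S π
  phi_smooth : ContDiffOn ℝ ∞ φ S
  phi_simple : ∀ Y Z : F → F, IsSmoothVectorField S Y → IsSmoothVectorField S Z →
    ∀ q ∈ N.Q, gyroscopicTensor N S π Y Z q =
      fderivWithin ℝ φ S (π q) (Z (π q)) • Y (π q) - fderivWithin ℝ φ S (π q) (Y (π q)) • Z (π q)

end Nonholonomic

namespace RouthSphere

/-! The rubber Routh sphere in `ℝⁿ`, where `n = d + 1`. Coordinates are indexed by `Fin (d + 1)`,
and the last one is the `n`-th. Vectors are plain functions; the Euclidean inner product is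
`⬝ᵥ`. -/

/-- The ambient space of the configurations `(R, x)`. -/
abbrev Ambient (d : ℕ) : Type :=
  Matrix (Fin (d + 1)) (Fin (d + 1)) ℝ × (Fin (d + 1) → ℝ)

/-- The `n`-th vector of the canonical basis (`e_n` in the space frame, `E_n` in the body frame). -/
def lastVec (d : ℕ) : Fin (d + 1) → ℝ := Pi.single (Fin.last d) 1

/-- `Q = SO(n) × ℝⁿ⁻¹`, embedded by the holonomic constraint `x_n = b`. -/
def configSpace (d : ℕ) (b : ℝ) : Set (Ambient d) :=
  {q | q.1 ∈ Matrix.specialOrthogonalGroup (Fin (d + 1)) ℝ ∧ q.2 (Fin.last d) = b}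

/-- The Poisson vector `γ = R⁻¹ e_n` (`R⁻¹ = Rᵀ` for a rotation `R`). -/
def poisson (d : ℕ) (q : Ambient d) : Fin (d + 1) → ℝ := q.1ᵀ *ᵥ lastVec d

/-- The unit sphere `Sⁿ⁻¹` of `ℝⁿ`. -/
def unitSphere (d : ℕ) : Set (Fin (d + 1) → ℝ) := {γ | γ ⬝ᵥ γ = 1}

/-- The angular velocity `Ω = R⁻¹ Ṙ` in the body frame. -/
def bodyVel (d : ℕ) (q v : Ambient d) : Matrix (Fin (d + 1)) (Fin (d + 1)) ℝ := q.1ᵀ * v.1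

/-- The angular velocity `ω = Ṙ R⁻¹` in the space frame. -/
def spaceVel (d : ℕ) (q v : Ambient d) : Matrix (Fin (d + 1)) (Fin (d + 1)) ℝ := v.1 * q.1ᵀ

/-- The constraint distribution: rolling without slipping, `ẋ = b ω e_n`, and the rubber (no spin)
constraint, `ω_ij = 0` for `i, j ≤ n - 1`. -/
def distribution (d : ℕ) (b : ℝ) (q : Ambient d) : Submodule ℝ (Ambient d) where
  carrier := {v | v ∈ tangentSpaceAt (configSpace d b) q ∧
    v.2 = b • (spaceVel d q v *ᵥ lastVec d) ∧
    ∀ i j : Fin d, spaceVel d q v i.castSucc j.castSucc = 0}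
  zero_mem' := by
    refine ⟨Submodule.zero_mem _, ?_, ?_⟩ <;> simp [spaceVel]
  add_mem' := by
    rintro v w ⟨hv, hv2, hv3⟩ ⟨hw, hw2, hw3⟩
    refine ⟨Submodule.add_mem _ hv hw, ?_, fun i j => ?_⟩
    · simp only [spaceVel, Prod.fst_add, Prod.snd_add, Matrix.add_mul, Matrix.add_mulVec,
        smul_add] at *
      rw [hv2, hw2]
    · have h1 := hv3 i j
      have h2 := hw3 i j
      simp only [spaceVel, Prod.fst_add, Matrix.add_mul, Matrix.add_apply] at *
      rw [h1, h2, add_zero]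
  smul_mem' := by
    rintro c v ⟨hv, hv2, hv3⟩
    refine ⟨Submodule.smul_mem _ c hv, ?_, fun i j => ?_⟩
    · simp only [spaceVel, Prod.smul_fst, Prod.smul_snd, Matrix.smul_mul,
        Matrix.smul_mulVec] at *
      rw [hv2, smul_comm]
    · have h1 := hv3 i j
      simp only [spaceVel, Prod.smul_fst, Matrix.smul_mul, Matrix.smul_apply] at *
      rw [h1, smul_zero]

/-- The mass tensor `𝕁 = diag(J₁, …, J₁, Jₙ)`. -/
def massTensor (d : ℕ) (J₁ Jₙ : ℝ) : Matrix (Fin (d + 1)) (Fin (d + 1)) ℝ :=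
  Matrix.diagonal fun i => if i = Fin.last d then Jₙ else J₁

/-- The inertia tensor `𝕀(Ω) = 𝕁 Ω + Ω 𝕁`. -/
def inertia (d : ℕ) (J₁ Jₙ : ℝ) (Ω : Matrix (Fin (d + 1)) (Fin (d + 1)) ℝ) :
    Matrix (Fin (d + 1)) (Fin (d + 1)) ℝ :=
  massTensor d J₁ Jₙ * Ω + Ω * massTensor d J₁ Jₙ

/-- The Killing metric `(ξ, η)_κ = - tr(ξ η) / 2`. -/
noncomputable def killing {d : ℕ} (ξ η : Matrix (Fin (d + 1)) (Fin (d + 1)) ℝ) : ℝ :=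
  -(1 / 2) * (ξ * η).trace

/-- The velocity of the centre of mass in the body frame, `R⁻¹ ẋ + ℓ Ω E_n`. -/
def massCentreVel (d : ℕ) (ℓ : ℝ) (q v : Ambient d) : Fin (d + 1) → ℝ :=
  q.1ᵀ *ᵥ v.2 + ℓ • (bodyVel d q v *ᵥ lastVec d)

/-- The kinetic energy metric
`⟪v, w⟫ = (𝕀 Ω_v, Ω_w)_κ + m (R⁻¹ ẋ_v + ℓ Ω_v E_n, R⁻¹ ẋ_w + ℓ Ω_w E_n)`. -/
noncomputable def kineticMetric (d : ℕ) (m ℓ J₁ Jₙ : ℝ) (q : Ambient d) :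
    LinearMap.BilinForm ℝ (Ambient d) :=
  LinearMap.mk₂ ℝ
    (fun v w => killing (inertia d J₁ Jₙ (bodyVel d q v)) (bodyVel d q w) +
      m * (massCentreVel d ℓ q v ⬝ᵥ massCentreVel d ℓ q w))
    (by
      intro v v₂ w
      simp only [killing, inertia, bodyVel, massCentreVel, Prod.fst_add, Prod.snd_add,
        Matrix.mul_add, Matrix.add_mul, Matrix.trace_add, Matrix.mulVec_add, Matrix.add_mulVec,
        smul_add, add_dotProduct, dotProduct_add]
      ring)
    (by
      intro c v w
      simp only [killing, inertia, bodyVel, massCentreVel, Prod.smul_fst, Prod.smul_snd,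
        Matrix.mul_smul, Matrix.smul_mul, ← smul_add, Matrix.trace_smul, Matrix.mulVec_smul,
        Matrix.smul_mulVec, smul_comm ℓ c, smul_dotProduct, smul_eq_mul]
      ring)
    (by
      intro v w w₂
      simp only [killing, inertia, bodyVel, massCentreVel, Prod.fst_add, Prod.snd_add,
        Matrix.mul_add, Matrix.add_mul, Matrix.trace_add, Matrix.mulVec_add, Matrix.add_mulVec,
        smul_add, add_dotProduct, dotProduct_add]
      ring)
    (by
      intro c v w
      simp only [killing, inertia, bodyVel, massCentreVel, Prod.smul_fst, Prod.smul_snd,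
        Matrix.mul_smul, ← smul_add, Matrix.trace_smul, Matrix.mulVec_smul,
        Matrix.smul_mulVec, smul_comm ℓ c, dotProduct_smul, smul_eq_mul]
      ring)

/-- The rubber Routh sphere in `ℝ^(d+1)`, of mass `m` and radius `b`, with centre of mass at distance
`ℓ` from the geometric centre, mass tensor `diag(J₁, …, J₁, Jₙ)` and gravitational constant `grav`;
the potential energy is `m grav ℓ γ_n`. -/
noncomputable def system (d : ℕ) (m b ℓ grav J₁ Jₙ : ℝ) : NonholonomicData (Ambient d) where
  Q := configSpace d b
  D := distribution d b
  metric := kineticMetric d m ℓ J₁ Jₙ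
  potential := fun q => m * grav * ℓ * poisson d q (Fin.last d)

/-- The matrix `(h y; 0 1)`. -/
def seMatrix {d : ℕ} (h : Matrix (Fin (d + 1)) (Fin (d + 1)) ℝ) (y : Fin (d + 1) → ℝ) :
    Matrix (Fin (d + 1) ⊕ Unit) (Fin (d + 1) ⊕ Unit) ℝ :=
  Matrix.fromBlocks h (Matrix.replicateCol Unit y) 0 1

/-- Rotations of `ℝⁿ` that fix `e_n`, i.e. the block matrices `diag(h̃, 1)` with `h̃ ∈ SO(n - 1)`. -/
def IsHorizontalRotation {d : ℕ} (h : Matrix (Fin (d + 1)) (Fin (d + 1)) ℝ) : Prop :=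
  h ∈ Matrix.specialOrthogonalGroup (Fin (d + 1)) ℝ ∧ h *ᵥ lastVec d = lastVec d

theorem seMatrix_one {d : ℕ} :
    seMatrix (1 : Matrix (Fin (d + 1)) (Fin (d + 1)) ℝ) 0 = 1 := by
  ext (i | i) (j | j) <;> simp [seMatrix, Matrix.one_apply]

theorem seMatrix_mul {d : ℕ} (h₁ h₂ : Matrix (Fin (d + 1)) (Fin (d + 1)) ℝ)
    (y₁ y₂ : Fin (d + 1) → ℝ) :
    seMatrix h₁ y₁ * seMatrix h₂ y₂ = seMatrix (h₁ * h₂) (h₁ *ᵥ y₂ + y₁) := by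
  rw [seMatrix, seMatrix, Matrix.fromBlocks_multiply]
  ext (i | i) (j | j) <;> simp [seMatrix, Matrix.mul_apply, Matrix.mulVec, dotProduct]

theorem mulVec_last {d : ℕ} {h : Matrix (Fin (d + 1)) (Fin (d + 1)) ℝ}
    (hs : h ∈ Matrix.specialOrthogonalGroup (Fin (d + 1)) ℝ) (he : h *ᵥ lastVec d = lastVec d)
    (y : Fin (d + 1) → ℝ) : (h *ᵥ y) (Fin.last d) = y (Fin.last d) := by
  have h1 : hᵀ * h = 1 :=
    (Matrix.mem_orthogonalGroup_iff' _ _).mp (Matrix.mem_specialOrthogonalGroup_iff.mp hs).1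
  have he2 : hᵀ *ᵥ lastVec d = lastVec d := by
    conv_lhs => rw [← he, Matrix.mulVec_mulVec, h1, Matrix.one_mulVec]
  have key : ∀ z : Fin (d + 1) → ℝ, lastVec d ⬝ᵥ z = z (Fin.last d) := by
    intro z
    simp [lastVec]
  rw [← key (h *ᵥ y), Matrix.dotProduct_mulVec, ← Matrix.mulVec_transpose, he2, key]

/-- The group `SE(n - 1)`, as the subgroup of `GL(n + 1, ℝ)` of the matrices `(h y; 0 1)` with `h` a
rotation that fixes `e_n` and `y_n = 0`. -/
def specialEuclidean (d : ℕ) : Subgroup (GL (Fin (d + 1) ⊕ Unit) ℝ) where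
  carrier := {g | ∃ h y, IsHorizontalRotation h ∧ y (Fin.last d) = 0 ∧
    (g : Matrix (Fin (d + 1) ⊕ Unit) (Fin (d + 1) ⊕ Unit) ℝ) = seMatrix h y}
  one_mem' := by
    exact ⟨1, 0, ⟨one_mem _, by simp⟩, rfl, by rw [seMatrix_one, Units.val_one]⟩
  mul_mem' := by
    rintro g₁ g₂ ⟨h₁, y₁, ⟨hs₁, he₁⟩, hy₁, hg₁⟩ ⟨h₂, y₂, ⟨hs₂, he₂⟩, hy₂, hg₂⟩
    refine ⟨h₁ * h₂, h₁ *ᵥ y₂ + y₁, ⟨mul_mem hs₁ hs₂, ?_⟩, ?_, ?_⟩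
    · rw [← Matrix.mulVec_mulVec, he₂, he₁]
    · rw [Pi.add_apply, hy₁, mulVec_last hs₁ he₁, hy₂, add_zero]
    · rw [Units.val_mul, hg₁, hg₂, seMatrix_mul]
  inv_mem' := by
    rintro g ⟨h, y, ⟨hs, he⟩, hy, hg⟩
    have ho := (Matrix.mem_specialOrthogonalGroup_iff.mp hs).1
    have h1 : hᵀ * h = 1 := (Matrix.mem_orthogonalGroup_iff' _ _).mp ho
    have hs2 : hᵀ ∈ Matrix.specialOrthogonalGroup (Fin (d + 1)) ℝ := by
      refine Matrix.mem_specialOrthogonalGroup_iff.mpr ⟨?_, ?_⟩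
      · exact (Matrix.mem_orthogonalGroup_iff _ _).mpr h1
      · rw [Matrix.det_transpose]
        exact (Matrix.mem_specialOrthogonalGroup_iff.mp hs).2
    have he2 : hᵀ *ᵥ lastVec d = lastVec d := by
      conv_lhs => rw [← he, Matrix.mulVec_mulVec, h1, Matrix.one_mulVec]
    refine ⟨hᵀ, -(hᵀ *ᵥ y), ⟨hs2, he2⟩, ?_, ?_⟩
    · rw [Pi.neg_apply, mulVec_last hs2 he2, hy, neg_zero]
    · refine Units.inv_eq_of_mul_eq_one_left ?_
      rw [hg, seMatrix_mul, h1, add_neg_cancel, seMatrix_one]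

/-- The action `(h, y) · (R, x) = (h R, h x + y)`. -/
def seAction (d : ℕ) (g : Matrix (Fin (d + 1) ⊕ Unit) (Fin (d + 1) ⊕ Unit) ℝ) (q : Ambient d) :
    Ambient d :=
  (g.toBlocks₁₁ * q.1, g.toBlocks₁₁ *ᵥ q.2 + fun i => g (Sum.inl i) (Sum.inr ()))

/-- `φ(γ) = - ln(2 J₁ + (Jₙ - J₁) γ_n² + m (b + ℓ γ_n)²) / 2`. -/
noncomputable def phi (d : ℕ) (m b ℓ J₁ Jₙ : ℝ) (γ : Fin (d + 1) → ℝ) : ℝ :=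
  -(1 / 2) * Real.log (2 * J₁ + (Jₙ - J₁) * γ (Fin.last d) ^ 2
    + m * (b + ℓ * γ (Fin.last d)) ^ 2)

/-- The form that `φ` takes for `n = 3` in terms of the principal moments of inertia. -/
noncomputable def phiThree (m b ℓ I₁ I₃ : ℝ) (γ : Fin 3 → ℝ) : ℝ :=
  -(1 / 2) * Real.log (I₁ * γ 2 ^ 2 + I₃ * (1 - γ 2 ^ 2) + m * (b + ℓ * γ 2) ^ 2)

/-- The element `E_i ∧ E_j = E_i E_jᵗ - E_j E_iᵗ` of `𝔰𝔬(n)`. -/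
def basisWedge {d : ℕ} (i j : Fin (d + 1)) : Matrix (Fin (d + 1)) (Fin (d + 1)) ℝ :=
  Matrix.single i j 1 - Matrix.single j i 1

end RouthSphere

/-! A skew `ω` whose block `ω_ij`, `i, j ≤ n - 1`, vanishes is `u ∧ e_n` with `u = ω e_n`
horizontal, so `D_q` is parametrised by `u ↦ rollVec b u q` (`mem_distribution_iff`). Infinitesimal
symmetries have angular velocity `ξ` with `ξ e_n = 0`; splitting `ω` according to `ω e_n` therefore
gives the Chaplygin property.

Along `rollVec b u q` the vector `γ` moves with velocity `-Rᵀ u`, so the horizontal lift of `v ⊥ γ`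
is given by `u = -R v`. Two facts determine the bracket of the lifts of `Y` and `Z`: the part coming
from the fields themselves is the lift of `[Y, Z]`, and the commutator of `w ∧ e_n` with `u ∧ e_n`
is the pure spin `u ∧ w` (`wedge_commutator`, `lieBracketWithin_rollVec`). So `[hor Y, hor Z]` is
the lift of `[Y, Z]` plus the spin whose body angular velocity is `Y ∧ Z`, and the gyroscopic tensor
is the projection to the sphere of the `D`-component of this spin.

Write `P = 2 J₁ + (Jₙ - J₁) γ_n² + m (b + ℓ γ_n)²`, `c = (Jₙ - J₁) γ_n + m ℓ (b + ℓ γ_n)` and `p =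
Z_n Y - Y_n Z`. The product of the spin with the rolling velocity of `s` is `c (p · Rᵀ s)`
(`kineticMetric_spin_rollVec`). On `D` the metric is `P` times the Euclidean product plus a multiple
of the product of last components (`kineticMetric_rollVec_rollVec`). Since `p_n = 0`, the extra term
vanishes on `p`, and the `D`-component of the spin is `(c / P) rollVec b (R p) q`. Hence `𝒯(Y, Z) =
-(c / P) p`. As `dP/dγ_n = 2 c`, the function `φ = -ln(P) / 2` has `dφ = -(c / P) dγ_n`, which is
the claim. -/

section TangentCalculus

/-! ### Derivatives within a set, restricted to its tangent spaces. -/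

variable {E : Type*} [NormedAddCommGroup E] [NormedSpace ℝ E]
variable {F : Type*} [NormedAddCommGroup F] [NormedSpace ℝ F]
variable {G : Type*} [NormedAddCommGroup G] [NormedSpace ℝ G]
variable {H : Type*} [NormedAddCommGroup H] [NormedSpace ℝ H]

/-- On a submanifold of positive codimension a derivative within the set is not unique. Two
candidates agree on the tangent cone, hence by linearity on its span. -/
theorem eqOn_tangentSpaceAt {f : E → F} {f₁ f₂ : E →L[ℝ] F} {s : Set E} {x v : E}
    (h₁ : HasFDerivWithinAt f f₁ s x) (h₂ : HasFDerivWithinAt f f₂ s x)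
    (hv : v ∈ tangentSpaceAt s x) : f₁ v = f₂ v := by
  have h : Set.EqOn (f₁ : E →ₗ[ℝ] F) (f₂ : E →ₗ[ℝ] F) (Submodule.span ℝ (tangentConeAt ℝ s x)) :=
    LinearMap.eqOn_span' fun w hw => h₁.unique_on h₂ hw
  exact h hv

theorem map_mem_tangentSpaceAt {f : E → F} {f' : E →L[ℝ] F} {s : Set E} {t : Set F} {x v : E}
    (h : HasFDerivWithinAt f f' s x) (hst : Set.MapsTo f s t) (hv : v ∈ tangentSpaceAt s x) :
    f' v ∈ tangentSpaceAt t (f x) := by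
  have key : Submodule.span ℝ (tangentConeAt ℝ s x) ≤
      (tangentSpaceAt t (f x)).comap (f' : E →ₗ[ℝ] F) := by
    rw [Submodule.span_le]
    intro w hw
    exact Submodule.subset_span (tangentConeAt_mono hst.image_subset (h.mapsTo_tangent_cone hw))
  exact key hv

theorem mem_tangentSpaceAt_of_curve {c : ℝ → E} {s : Set E} {v : E}
    (h : HasDerivAt c v 0) (hc : ∀ t, c t ∈ s) : v ∈ tangentSpaceAt s (c 0) := by
  have h1 := map_mem_tangentSpaceAt (t := s) (v := (1 : ℝ))
    (h.hasFDerivAt.hasFDerivWithinAt (s := Set.univ)) (fun t _ => hc t)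
    (Submodule.subset_span (by simp [tangentConeAt_univ]))
  simpa using h1

/-- `f` is differentiable within `s` at `x`, with a derivative that maps `v` to `w`. -/
def HasDirDerivWithin (f : E → F) (s : Set E) (x v : E) (w : F) : Prop :=
  ∃ f' : E →L[ℝ] F, HasFDerivWithinAt f f' s x ∧ f' v = w

namespace HasDirDerivWithin

variable {s : Set E} {x v : E}

theorem fderivWithin_apply {f : E → F} {w : F} (h : HasDirDerivWithin f s x v w)
    (hv : v ∈ tangentSpaceAt s x) : fderivWithin ℝ f s x v = w := by
  obtain ⟨f', hf, rfl⟩ := h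
  exact eqOn_tangentSpaceAt hf.differentiableWithinAt.hasFDerivWithinAt hf hv

theorem unique {f : E → F} {w₁ w₂ : F} (h₁ : HasDirDerivWithin f s x v w₁)
    (h₂ : HasDirDerivWithin f s x v w₂) (hv : v ∈ tangentSpaceAt s x) : w₁ = w₂ := by
  rw [← h₁.fderivWithin_apply hv, ← h₂.fderivWithin_apply hv]

theorem mem_tangentSpaceAt {f : E → F} {w : F} {t : Set F} (h : HasDirDerivWithin f s x v w)
    (hst : Set.MapsTo f s t) (hv : v ∈ tangentSpaceAt s x) : w ∈ tangentSpaceAt t (f x) := by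
  obtain ⟨f', hf, rfl⟩ := h
  exact map_mem_tangentSpaceAt hf hst hv

theorem congr {f g : E → F} {w : F} (h : HasDirDerivWithin f s x v w) (hfg : ∀ y ∈ s, g y = f y)
    (hx : x ∈ s) : HasDirDerivWithin g s x v w := by
  obtain ⟨f', hf, hw⟩ := h
  exact ⟨f', hf.congr hfg (hfg x hx), hw⟩

theorem congr_deriv {f : E → F} {w z : F} (h : HasDirDerivWithin f s x v w) (hwz : w = z) :
    HasDirDerivWithin f s x v z :=
  hwz ▸ h

theorem const (c : F) : HasDirDerivWithin (fun _ : E => c) s x v 0 :=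
  ⟨0, hasFDerivWithinAt_const c x s, rfl⟩

/-- Differentiating an identity valid on `s`: the source of every linear equation satisfied by
tangent vectors below. -/
theorem of_const {f : E → F} {c w : F} (h : HasDirDerivWithin f s x v w) (hf : ∀ y ∈ s, f y = c)
    (hx : x ∈ s) (hv : v ∈ tangentSpaceAt s x) : w = 0 :=
  h.unique ((const c).congr hf hx) hv

theorem of_differentiable {f : E → F} (h : DifferentiableWithinAt ℝ f s x) :
    HasDirDerivWithin f s x v (fderivWithin ℝ f s x v) :=
  ⟨_, h.hasFDerivWithinAt, rfl⟩

theorem comp {f : E → F} {g : F → G} {t : Set F} {w : F} {z : G}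
    (hg : HasDirDerivWithin g t (f x) w z) (hf : HasDirDerivWithin f s x v w)
    (hst : Set.MapsTo f s t) : HasDirDerivWithin (fun y => g (f y)) s x v z := by
  obtain ⟨f', hf, rfl⟩ := hf
  obtain ⟨g', hg, rfl⟩ := hg
  exact ⟨g'.comp f', hg.comp x hf hst, rfl⟩

theorem linear [FiniteDimensional ℝ F] {f : E → F} {w : F} (L : F →ₗ[ℝ] G)
    (hf : HasDirDerivWithin f s x v w) : HasDirDerivWithin (fun y => L (f y)) s x v (L w) := by
  obtain ⟨f', hf, rfl⟩ := hf
  exact ⟨(LinearMap.toContinuousLinearMap L).comp f',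
    (LinearMap.toContinuousLinearMap L).hasFDerivAt.comp_hasFDerivWithinAt x hf, rfl⟩

theorem id : HasDirDerivWithin (fun y : E => y) s x v v :=
  ⟨ContinuousLinearMap.id ℝ E, hasFDerivWithinAt_id x s, rfl⟩

theorem bilinear [FiniteDimensional ℝ F] [FiniteDimensional ℝ G] {f : E → F} {g : E → G}
    {w : F} {z : G} (B : F →ₗ[ℝ] G →ₗ[ℝ] H)
    (hf : HasDirDerivWithin f s x v w) (hg : HasDirDerivWithin g s x v z) :
    HasDirDerivWithin (fun y => B (f y) (g y)) s x v (B (f x) z + B w (g x)) := by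
  obtain ⟨f', hf, rfl⟩ := hf
  obtain ⟨g', hg, rfl⟩ := hg
  exact ⟨_, B.toContinuousBilinearMap.hasFDerivWithinAt_of_bilinear hf hg, by simp⟩

theorem sub {f g : E → F} {w z : F} (hf : HasDirDerivWithin f s x v w)
    (hg : HasDirDerivWithin g s x v z) :
    HasDirDerivWithin (fun y => f y - g y) s x v (w - z) := by
  obtain ⟨f', hf, rfl⟩ := hf
  obtain ⟨g', hg, rfl⟩ := hg
  exact ⟨_, hf.sub hg, rfl⟩

theorem const_smul {f : E → F} {w : F} (c : ℝ) (hf : HasDirDerivWithin f s x v w) :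
    HasDirDerivWithin (fun y => c • f y) s x v (c • w) := by
  obtain ⟨f', hf, rfl⟩ := hf
  exact ⟨_, hf.const_smul c, rfl⟩

theorem prodMk {f : E → F} {g : E → G} {w : F} {z : G} (hf : HasDirDerivWithin f s x v w)
    (hg : HasDirDerivWithin g s x v z) :
    HasDirDerivWithin (fun y => (f y, g y)) s x v (w, z) := by
  obtain ⟨f', hf, rfl⟩ := hf
  obtain ⟨g', hg, rfl⟩ := hg
  exact ⟨_, hf.prodMk hg, rfl⟩

theorem lieBracketWithin_eq {X Y : E → E} {w z : E} (hX : HasDirDerivWithin X s x (Y x) w)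
    (hY : HasDirDerivWithin Y s x (X x) z) (hXx : X x ∈ tangentSpaceAt s x)
    (hYx : Y x ∈ tangentSpaceAt s x) :
    VectorField.lieBracketWithin ℝ X Y s x = z - w := by
  rw [VectorField.lieBracketWithin_eq]
  simp only [hX.fderivWithin_apply hYx, hY.fderivWithin_apply hXx]

end HasDirDerivWithin

theorem ContDiffOn.linear [FiniteDimensional ℝ F] {s : Set E} {f : E → F} (L : F →ₗ[ℝ] G)
    (hf : ContDiffOn ℝ ∞ f s) : ContDiffOn ℝ ∞ (fun y => L (f y)) s :=
  (LinearMap.toContinuousLinearMap L).contDiff.comp_contDiffOn hf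

theorem ContDiffOn.bilinear [FiniteDimensional ℝ F] [FiniteDimensional ℝ G] {s : Set E}
    {f : E → F} {g : E → G} (B : F →ₗ[ℝ] G →ₗ[ℝ] H)
    (hf : ContDiffOn ℝ ∞ f s) (hg : ContDiffOn ℝ ∞ g s) :
    ContDiffOn ℝ ∞ (fun y => B (f y) (g y)) s :=
  B.toContinuousBilinearMap.isBoundedBilinearMap.contDiff.comp_contDiffOn (hf.prodMk hg)

end TangentCalculus

/-! ### Product rules for matrix and vector valued maps. -/

section MatrixCalculus

variable {E : Type*} [NormedAddCommGroup E] [NormedSpace ℝ E]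
variable {ι : Type*} [Fintype ι] {s : Set E} {x v : E}

namespace HasDirDerivWithin

theorem transpose {A : E → Matrix ι ι ℝ} {A' : Matrix ι ι ℝ} (h : HasDirDerivWithin A s x v A') :
    HasDirDerivWithin (fun y => (A y)ᵀ) s x v A'ᵀ :=
  h.linear (Matrix.transposeLinearEquiv ι ι ℝ ℝ).toLinearMap

theorem matrixMul [DecidableEq ι] {A B : E → Matrix ι ι ℝ} {A' B' : Matrix ι ι ℝ}
    (hA : HasDirDerivWithin A s x v A') (hB : HasDirDerivWithin B s x v B') :
    HasDirDerivWithin (fun y => A y * B y) s x v (A x * B' + A' * B x) :=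
  hA.bilinear (LinearMap.mul ℝ (Matrix ι ι ℝ)) hB

theorem mulVec {A : E → Matrix ι ι ℝ} {A' : Matrix ι ι ℝ} {u : E → ι → ℝ} {u' : ι → ℝ}
    (hA : HasDirDerivWithin A s x v A') (hu : HasDirDerivWithin u s x v u') :
    HasDirDerivWithin (fun y => A y *ᵥ u y) s x v (A x *ᵥ u' + A' *ᵥ u x) :=
  hA.bilinear (Matrix.mulVecBilin ℝ ℝ) hu

theorem dotProduct {u w : E → ι → ℝ} {u' w' : ι → ℝ}
    (hu : HasDirDerivWithin u s x v u') (hw : HasDirDerivWithin w s x v w') :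
    HasDirDerivWithin (fun y => u y ⬝ᵥ w y) s x v (u x ⬝ᵥ w' + u' ⬝ᵥ w x) :=
  hu.bilinear (dotProductBilin ℝ ℝ) hw

theorem apply {u : E → ι → ℝ} {u' : ι → ℝ} (hu : HasDirDerivWithin u s x v u') (i : ι) :
    HasDirDerivWithin (fun y => u y i) s x v (u' i) :=
  hu.linear (LinearMap.proj i : (ι → ℝ) →ₗ[ℝ] ℝ)

end HasDirDerivWithin

namespace ContDiffOn

theorem transpose {A : E → Matrix ι ι ℝ} (h : ContDiffOn ℝ ∞ A s) :
    ContDiffOn ℝ ∞ (fun y => (A y)ᵀ) s :=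
  h.linear (Matrix.transposeLinearEquiv ι ι ℝ ℝ).toLinearMap

theorem trace {A : E → Matrix ι ι ℝ} (h : ContDiffOn ℝ ∞ A s) :
    ContDiffOn ℝ ∞ (fun y => (A y).trace) s :=
  h.linear (Matrix.traceLinearMap ι ℝ ℝ)

theorem matrixMul [DecidableEq ι] {A B : E → Matrix ι ι ℝ} (hA : ContDiffOn ℝ ∞ A s)
    (hB : ContDiffOn ℝ ∞ B s) :
    ContDiffOn ℝ ∞ (fun y => A y * B y) s :=
  hA.bilinear (LinearMap.mul ℝ (Matrix ι ι ℝ)) hB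

theorem mulVec {A : E → Matrix ι ι ℝ} {u : E → ι → ℝ} (hA : ContDiffOn ℝ ∞ A s)
    (hu : ContDiffOn ℝ ∞ u s) : ContDiffOn ℝ ∞ (fun y => A y *ᵥ u y) s :=
  hA.bilinear (Matrix.mulVecBilin ℝ ℝ) hu

theorem dotProduct {u w : E → ι → ℝ} (hu : ContDiffOn ℝ ∞ u s) (hw : ContDiffOn ℝ ∞ w s) :
    ContDiffOn ℝ ∞ (fun y => u y ⬝ᵥ w y) s :=
  hu.bilinear (dotProductBilin ℝ ℝ) hw

theorem apply {u : E → ι → ℝ} (hu : ContDiffOn ℝ ∞ u s) (i : ι) :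
    ContDiffOn ℝ ∞ (fun y => u y i) s :=
  hu.linear (LinearMap.proj i : (ι → ℝ) →ₗ[ℝ] ℝ)

end ContDiffOn

end MatrixCalculus

/-! ### Algebra of bivectors. -/

section Wedge

variable {ι : Type*}

/-- The bivector `u ∧ w = u wᵗ - w uᵗ`. -/
def wedge (u w : ι → ℝ) : Matrix ι ι ℝ := Matrix.vecMulVec u w - Matrix.vecMulVec w u

theorem wedge_apply (u w : ι → ℝ) (i j : ι) : wedge u w i j = u i * w j - w i * u j := rfl

theorem wedge_transpose (u w : ι → ℝ) : (wedge u w)ᵀ = -wedge u w := by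
  ext i j
  simp only [Matrix.transpose_apply, Matrix.neg_apply, wedge_apply]
  ring

theorem wedge_add_left (u v w : ι → ℝ) : wedge (u + v) w = wedge u w + wedge v w := by
  ext i j
  simp only [Matrix.add_apply, wedge_apply, Pi.add_apply]
  ring

theorem wedge_sub_left (u v w : ι → ℝ) : wedge (u - v) w = wedge u w - wedge v w := by
  ext i j
  simp only [Matrix.sub_apply, wedge_apply, Pi.sub_apply]
  ring

theorem wedge_smul_left (c : ℝ) (u w : ι → ℝ) : wedge (c • u) w = c • wedge u w := by
  ext i j
  simp only [Matrix.smul_apply, wedge_apply, Pi.smul_apply, smul_eq_mul]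
  ring

variable [Fintype ι]

theorem wedge_mulVec (u w z : ι → ℝ) : wedge u w *ᵥ z = (w ⬝ᵥ z) • u - (u ⬝ᵥ z) • w := by
  ext i
  simp only [Matrix.mulVec, wedge_apply, dotProduct, Pi.sub_apply, Pi.smul_apply, smul_eq_mul,
    Finset.sum_mul, ← Finset.sum_sub_distrib]
  exact Finset.sum_congr rfl fun j _ => by ring

theorem mul_wedge_mul_transpose (M : Matrix ι ι ℝ) (u w : ι → ℝ) :
    M * wedge u w * Mᵀ = wedge (M *ᵥ u) (M *ᵥ w) := by
  simp only [wedge, Matrix.mul_sub, Matrix.sub_mul, Matrix.mul_vecMulVec, Matrix.vecMulVec_mul,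
    Matrix.vecMul_transpose]

theorem trace_vecMulVec_mul (u w : ι → ℝ) (M : Matrix ι ι ℝ) :
    (Matrix.vecMulVec u w * M).trace = w ⬝ᵥ M *ᵥ u := by
  rw [Matrix.vecMulVec_mul, Matrix.trace_vecMulVec, dotProduct_comm, Matrix.dotProduct_mulVec]

theorem trace_wedge_mul_wedge (a c u w : ι → ℝ) :
    (wedge a c * wedge u w).trace =
      2 * ((a ⬝ᵥ w) * (c ⬝ᵥ u) - (a ⬝ᵥ u) * (c ⬝ᵥ w)) := by
  rw [wedge, Matrix.sub_mul, Matrix.trace_sub, trace_vecMulVec_mul, trace_vecMulVec_mul,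
    wedge_mulVec, wedge_mulVec]
  simp only [dotProduct_sub, dotProduct_smul, smul_eq_mul, dotProduct_comm w, dotProduct_comm u]
  ring

/-- The product `(u ∧ e)(v ∧ e)` is `-u vᵗ - (u · v) e eᵗ`; its second term is symmetric in `u` and
`v` and drops out of the commutator. This is how rolling motions generate spin. -/
theorem wedge_commutator {e a c : ι → ℝ} (he : e ⬝ᵥ e = 1) (ha : e ⬝ᵥ a = 0) (hc : e ⬝ᵥ c = 0) :
    wedge a e * wedge c e - wedge c e * wedge a e = wedge c a := by
  have key : ∀ u v : ι → ℝ, e ⬝ᵥ u = 0 → e ⬝ᵥ v = 0 → wedge u e * wedge v e =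
      -Matrix.vecMulVec u v - (u ⬝ᵥ v) • Matrix.vecMulVec e e := by
    intro u v hu hv
    rw [wedge, Matrix.sub_mul, Matrix.vecMulVec_mul, Matrix.vecMulVec_mul,
      ← Matrix.mulVec_transpose, ← Matrix.mulVec_transpose, wedge_transpose, Matrix.neg_mulVec,
      Matrix.neg_mulVec, wedge_mulVec, wedge_mulVec, he, dotProduct_comm v e, hv, hu,
      dotProduct_comm v u]
    ext i j
    simp only [Matrix.vecMulVec_apply, Matrix.sub_apply, Matrix.neg_apply, Matrix.smul_apply,
      Pi.neg_apply, Pi.sub_apply, Pi.smul_apply, smul_eq_mul]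
    ring
  rw [key a c ha hc, key c a hc ha, wedge, dotProduct_comm c a]
  abel

end Wedge

namespace RouthSphere

variable {d : ℕ}

theorem lastVec_dotProduct (u : Fin (d + 1) → ℝ) : lastVec d ⬝ᵥ u = u (Fin.last d) := by
  simp [lastVec]

theorem lastVec_last : lastVec d (Fin.last d) = 1 := by simp [lastVec]

theorem lastVec_castSucc (i : Fin d) : lastVec d i.castSucc = 0 := by
  simp [lastVec, Fin.ext_iff, i.isLt.ne]

theorem lastVec_dotProduct_self : lastVec d ⬝ᵥ lastVec d = 1 := by
  rw [lastVec_dotProduct, lastVec_last]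

/-! ### Rotations and exponentials of skew matrices. -/

section SpecialOrthogonal

variable {R : Matrix (Fin (d + 1)) (Fin (d + 1)) ℝ}

theorem transpose_mul_self_of_mem (hR : R ∈ Matrix.specialOrthogonalGroup (Fin (d + 1)) ℝ) :
    Rᵀ * R = 1 :=
  (Matrix.mem_orthogonalGroup_iff' _ _).mp (Matrix.mem_specialOrthogonalGroup_iff.mp hR).1

theorem mul_transpose_self_of_mem (hR : R ∈ Matrix.specialOrthogonalGroup (Fin (d + 1)) ℝ) :
    R * Rᵀ = 1 :=
  (Matrix.mem_orthogonalGroup_iff _ _).mp (Matrix.mem_specialOrthogonalGroup_iff.mp hR).1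

theorem transpose_mem (hR : R ∈ Matrix.specialOrthogonalGroup (Fin (d + 1)) ℝ) :
    Rᵀ ∈ Matrix.specialOrthogonalGroup (Fin (d + 1)) ℝ := by
  refine Matrix.mem_specialOrthogonalGroup_iff.mpr ⟨?_, ?_⟩
  · exact (Matrix.mem_orthogonalGroup_iff _ _).mpr (by
      simpa [Matrix.star_eq_conjTranspose] using transpose_mul_self_of_mem hR)
  · rw [Matrix.det_transpose]
    exact (Matrix.mem_specialOrthogonalGroup_iff.mp hR).2

theorem mem_specialOrthogonalGroup_iff_transpose :
    R ∈ Matrix.specialOrthogonalGroup (Fin (d + 1)) ℝ ↔ Rᵀ * R = 1 ∧ R.det = 1 := by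
  rw [Matrix.mem_specialOrthogonalGroup_iff, Matrix.mem_orthogonalGroup_iff']

theorem det_sq_eq_one (h : Rᵀ * R = 1) : R.det * R.det = 1 := by
  have := congrArg Matrix.det h
  rwa [Matrix.det_mul, Matrix.det_transpose, Matrix.det_one] at this

/-- Orthogonality is `exp(-A) exp(A) = 1`. The determinant is `1` rather than `-1` because `exp R`
is the square of the orthogonal matrix `exp(R / 2)`. -/
theorem exp_mem_specialOrthogonalGroup (h : Rᵀ = -R) :
    NormedSpace.exp R ∈ Matrix.specialOrthogonalGroup (Fin (d + 1)) ℝ := by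
  have orth : ∀ A : Matrix (Fin (d + 1)) (Fin (d + 1)) ℝ, Aᵀ = -A →
      (NormedSpace.exp A)ᵀ * NormedSpace.exp A = 1 := by
    intro A hA
    rw [← Matrix.exp_transpose, hA, ← Matrix.exp_add_of_commute _ _ (Commute.refl A).neg_left,
      neg_add_cancel, NormedSpace.exp_zero]
  refine mem_specialOrthogonalGroup_iff_transpose.mpr ⟨orth R h, ?_⟩
  have h2 : NormedSpace.exp R =
      NormedSpace.exp ((1 / 2 : ℝ) • R) * NormedSpace.exp ((1 / 2 : ℝ) • R) := by
    rw [← Matrix.exp_add_of_commute _ _ (Commute.refl _), ← add_smul]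
    norm_num
  rw [h2, Matrix.det_mul]
  exact det_sq_eq_one (orth _ (by rw [Matrix.transpose_smul, h, smul_neg]))

/-- The matrix `e eᵗ` intertwines `0` and `R`, hence also `exp 0 = 1` and `exp R`; a column with `e
j ≠ 0` gives the vector identity. -/
theorem exp_mulVec_eq_self {e : Fin (d + 1) → ℝ} (h : R *ᵥ e = 0) :
    NormedSpace.exp R *ᵥ e = e := by
  have h1 : SemiconjBy (Matrix.vecMulVec e e) (0 : Matrix (Fin (d + 1)) (Fin (d + 1)) ℝ) R := by
    rw [SemiconjBy, mul_zero, Matrix.mul_vecMulVec, h, Matrix.zero_vecMulVec]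
  have h2 : Matrix.vecMulVec e e = NormedSpace.exp R * Matrix.vecMulVec e e := by
    have := h1.exp_right
    rwa [SemiconjBy, NormedSpace.exp_zero, mul_one] at this
  rw [Matrix.mul_vecMulVec] at h2
  by_cases he : e = 0
  · rw [he, Matrix.mulVec_zero]
  obtain ⟨j, hj⟩ := Function.ne_iff.mp he
  ext i
  have := congrFun (congrFun h2 i) j
  exact (mul_right_cancel₀ hj this).symm

theorem hasDerivAt_exp_smul_zero (A : Matrix (Fin (d + 1)) (Fin (d + 1)) ℝ) :
    HasDerivAt (fun t : ℝ => NormedSpace.exp (t • A)) A 0 := by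
  have := hasDerivAt_exp_smul_const (𝕂 := ℝ) A 0
  rw [zero_smul, NormedSpace.exp_zero, one_mul] at this
  exact this

end SpecialOrthogonal

/-! ### Tangent spaces of the configuration space and the constraint distribution. -/

section Configurations

variable {b : ℝ} {q v : Ambient d}

theorem poisson_dotProduct_self (hq : q ∈ configSpace d b) : poisson d q ⬝ᵥ poisson d q = 1 := by
  rw [poisson, Matrix.mulVec_transpose, ← Matrix.dotProduct_mulVec, ← Matrix.mulVec_transpose,
    Matrix.mulVec_mulVec, mul_transpose_self_of_mem hq.1, Matrix.one_mulVec,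
    lastVec_dotProduct_self]

theorem mulVec_poisson (hq : q ∈ configSpace d b) : q.1 *ᵥ poisson d q = lastVec d := by
  rw [poisson, Matrix.mulVec_mulVec, mul_transpose_self_of_mem hq.1, Matrix.one_mulVec]

theorem mulVec_dotProduct_mulVec (hq : q ∈ configSpace d b) (u w : Fin (d + 1) → ℝ) :
    q.1 *ᵥ u ⬝ᵥ q.1 *ᵥ w = u ⬝ᵥ w := by
  rw [Matrix.dotProduct_mulVec, ← Matrix.mulVec_transpose, Matrix.mulVec_mulVec,
    transpose_mul_self_of_mem hq.1, Matrix.one_mulVec]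

theorem mulVec_last_eq (u : Fin (d + 1) → ℝ) :
    (q.1 *ᵥ u) (Fin.last d) = poisson d q ⬝ᵥ u := by
  rw [← lastVec_dotProduct (q.1 *ᵥ u), Matrix.dotProduct_mulVec, ← Matrix.mulVec_transpose]
  rfl

/-- Differentiating `Rᵀ R = 1` and `x_n = b` gives the equations; conversely the curve `(R exp(t Ω),
x + t ẋ)` stays in the configuration space. -/
theorem mem_tangentSpaceAt_configSpace (hq : q ∈ configSpace d b) :
    v ∈ tangentSpaceAt (configSpace d b) q ↔
      (bodyVel d q v)ᵀ = -bodyVel d q v ∧ v.2 (Fin.last d) = 0 := by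
  constructor
  · intro hv
    have hid : HasDirDerivWithin (fun y : Ambient d => y) (configSpace d b) q v v := .id
    have h1 := hid.linear (LinearMap.fst ℝ _ _)
    have h2 := hid.linear (LinearMap.snd ℝ _ _)
    refine ⟨?_, (h2.apply (Fin.last d)).of_const (fun y hy => hy.2) hq hv⟩
    have h3 := (h1.transpose.matrixMul h1).of_const
      (fun y hy => transpose_mul_self_of_mem hy.1) hq hv
    simp only [LinearMap.fst_apply] at h3
    rw [bodyVel, Matrix.transpose_mul, Matrix.transpose_transpose]
    exact eq_neg_of_add_eq_zero_right h3
  · rintro ⟨h1, h2⟩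
    have hc : HasDerivAt (fun t : ℝ => ((q.1 * NormedSpace.exp (t • bodyVel d q v) : Matrix _ _ ℝ),
        q.2 + t • v.2)) (q.1 * bodyVel d q v, v.2) 0 := by
      refine ((hasDerivAt_exp_smul_zero _).const_mul q.1).prodMk ?_
      simpa using ((hasDerivAt_id (0 : ℝ)).smul_const v.2).const_add q.2
    have h3 := mem_tangentSpaceAt_of_curve (s := configSpace d b) hc (fun t => ⟨?_, ?_⟩)
    · rw [bodyVel, ← mul_assoc, mul_transpose_self_of_mem hq.1, one_mul] at h3
      simpa [NormedSpace.exp_zero] using h3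
    · refine mul_mem hq.1 (exp_mem_specialOrthogonalGroup ?_)
      rw [Matrix.transpose_smul, h1, smul_neg]
    · simp [h2, hq.2]

theorem spaceVel_eq (hq : q ∈ configSpace d b) :
    spaceVel d q v = q.1 * bodyVel d q v * q.1ᵀ := by
  rw [bodyVel, ← mul_assoc, mul_transpose_self_of_mem hq.1, one_mul, spaceVel]

theorem bodyVel_eq (hq : q ∈ configSpace d b) :
    bodyVel d q v = q.1ᵀ * spaceVel d q v * q.1 := by
  rw [spaceVel, mul_assoc, mul_assoc, transpose_mul_self_of_mem hq.1, mul_one, bodyVel]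

theorem fst_eq_spaceVel_mul (hq : q ∈ configSpace d b) : v.1 = spaceVel d q v * q.1 := by
  rw [spaceVel, mul_assoc, transpose_mul_self_of_mem hq.1, mul_one]

theorem mem_tangentSpaceAt_configSpace' (hq : q ∈ configSpace d b) :
    v ∈ tangentSpaceAt (configSpace d b) q ↔
      (spaceVel d q v)ᵀ = -spaceVel d q v ∧ v.2 (Fin.last d) = 0 := by
  rw [mem_tangentSpaceAt_configSpace hq]
  refine and_congr_left fun _ => ⟨fun h => ?_, fun h => ?_⟩
  · rw [spaceVel_eq hq, Matrix.transpose_mul, Matrix.transpose_mul, h, Matrix.transpose_transpose]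
    simp [mul_assoc]
  · rw [bodyVel_eq hq, Matrix.transpose_mul, Matrix.transpose_mul, h, Matrix.transpose_transpose]
    simp [mul_assoc]

/-- The velocity at `q` of the motion that satisfies the rubber rolling constraints and for which
`ω e_n = u`, where `u` is horizontal. -/
def rollVec (b : ℝ) (u : Fin (d + 1) → ℝ) (q : Ambient d) : Ambient d :=
  (wedge u (lastVec d) * q.1, b • u)

theorem rollVec_add (b : ℝ) (u w : Fin (d + 1) → ℝ) (q : Ambient d) :
    rollVec b (u + w) q = rollVec b u q + rollVec b w q := by
  simp [rollVec, wedge_add_left, Matrix.add_mul]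

theorem rollVec_smul (b c : ℝ) (u : Fin (d + 1) → ℝ) (q : Ambient d) :
    rollVec b (c • u) q = c • rollVec b u q := by
  simp [rollVec, wedge_smul_left, smul_comm b c]

theorem spaceVel_rollVec (hq : q ∈ configSpace d b) (u : Fin (d + 1) → ℝ) :
    spaceVel d q (rollVec b u q) = wedge u (lastVec d) := by
  rw [spaceVel, rollVec, mul_assoc, mul_transpose_self_of_mem hq.1, mul_one]

theorem bodyVel_rollVec (u : Fin (d + 1) → ℝ) :
    bodyVel d q (rollVec b u q) = wedge (q.1ᵀ *ᵥ u) (poisson d q) := by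
  have := mul_wedge_mul_transpose q.1ᵀ u (lastVec d)
  rw [Matrix.transpose_transpose, mul_assoc] at this
  exact this

theorem wedge_lastVec_mulVec {u : Fin (d + 1) → ℝ} (hu : u (Fin.last d) = 0) :
    wedge u (lastVec d) *ᵥ lastVec d = u := by
  rw [wedge_mulVec, lastVec_dotProduct_self, dotProduct_comm, lastVec_dotProduct, hu, one_smul,
    zero_smul, sub_zero]

/-- Skewness kills the corner entry and recovers the last row from the last column, which is all
that remains of `A`. -/
theorem eq_wedge_of_castSucc_eq_zero {A : Matrix (Fin (d + 1)) (Fin (d + 1)) ℝ} (hA : Aᵀ = -A)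
    (h : ∀ i j : Fin d, A i.castSucc j.castSucc = 0) : A = wedge (A *ᵥ lastVec d) (lastVec d) := by
  have hs : ∀ i j, A j i = -A i j := fun i j => congrFun (congrFun hA i) j
  have hl : ∀ i, (A *ᵥ lastVec d) i = A i (Fin.last d) := fun i => by simp [lastVec]
  ext i j
  rw [wedge_apply, hl, hl]
  induction i using Fin.lastCases with
  | last =>
    induction j using Fin.lastCases with
    | last =>
      have := hs (Fin.last d) (Fin.last d)
      rw [lastVec_last]
      linarith
    | cast j => rw [lastVec_castSucc, lastVec_last, hs j.castSucc]; ring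
  | cast i =>
    induction j using Fin.lastCases with
    | last => rw [lastVec_castSucc, lastVec_last]; ring
    | cast j => rw [lastVec_castSucc, lastVec_castSucc, h]; ring

theorem rollVec_mem_distribution (hq : q ∈ configSpace d b) {u : Fin (d + 1) → ℝ}
    (hu : u (Fin.last d) = 0) : rollVec b u q ∈ distribution d b q := by
  refine ⟨(mem_tangentSpaceAt_configSpace' hq).mpr ⟨?_, ?_⟩, ?_, fun i j => ?_⟩
  · rw [spaceVel_rollVec hq, wedge_transpose]
  · simp [rollVec, hu]
  · rw [spaceVel_rollVec hq, wedge_lastVec_mulVec hu, rollVec]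
  · rw [spaceVel_rollVec hq, wedge_apply, lastVec_castSucc, lastVec_castSucc]
    ring

/-- The parameter is `u = ω e_n`: the no-spin condition makes `ω` equal to `u ∧ e_n`, and rolling
fixes `ẋ = b u`. -/
theorem mem_distribution_iff (hq : q ∈ configSpace d b) :
    v ∈ distribution d b q ↔ ∃ u : Fin (d + 1) → ℝ, u (Fin.last d) = 0 ∧ v = rollVec b u q := by
  constructor
  · rintro ⟨hv, h2, h3⟩
    have hs := ((mem_tangentSpaceAt_configSpace' hq).mp hv).1
    have hw := eq_wedge_of_castSucc_eq_zero hs h3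
    refine ⟨spaceVel d q v *ᵥ lastVec d, ?_, Prod.ext ?_ h2⟩
    · have := congrFun (congrFun hs (Fin.last d)) (Fin.last d)
      simp only [Matrix.transpose_apply, Matrix.neg_apply] at this
      simp only [lastVec, Matrix.mulVec_single_one, Matrix.col_apply]
      linarith
    · rw [rollVec, ← hw]
      exact fst_eq_spaceVel_mul hq
  · rintro ⟨u, hu, rfl⟩
    exact rollVec_mem_distribution hq hu

end Configurations

end RouthSphere

/-! ### The configuration space and the sphere as embedded submanifolds. -/

theorem isEmbeddedSubmanifold_of_submersion {E : Type*} [NormedAddCommGroup E] [NormedSpace ℝ E]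
    {κ : Type*} [Fintype κ] {M U : Set E} {f : E → κ → ℝ} (hU : IsOpen U) (hMU : M ⊆ U)
    (hf : ContDiffOn ℝ ∞ f U) (hM : ∀ x ∈ U, x ∈ M ↔ f x = 0)
    (hs : ∀ x ∈ M, ∀ c, ∃ v, HasDirDerivWithin f Set.univ x v c) : IsEmbeddedSubmanifold M := by
  let e := Fintype.equivFin κ
  let L : (κ → ℝ) ≃ₗ[ℝ] (Fin (Fintype.card κ) → ℝ) := LinearEquiv.funCongrLeft ℝ ℝ e.symm
  refine ⟨Fintype.card κ, fun p hp => ⟨U, fun x => L (f x), hU, hMU hp, hf.linear L.toLinearMap,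
    fun x hx => ?_, fun x hx c => ?_⟩⟩
  · rw [hM x hx, LinearEquiv.map_eq_zero_iff]
  · obtain ⟨v, hv⟩ := hs x hx.2 (L.symm c)
    obtain ⟨f', hf', hfv⟩ := hv.linear L.toLinearMap
    refine ⟨v, ?_⟩
    rw [hasFDerivWithinAt_univ] at hf'
    have h2 := hf'.fderiv
    simp only [LinearEquiv.coe_coe] at h2
    rw [h2, hfv]
    simp

namespace RouthSphere

variable {d : ℕ} {b : ℝ}

/-- The index set of the equations `(Rᵗ R)_ij = δ_ij`, `i ≤ j`, and `x_n = b`. -/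
abbrev ConfigEquation (d : ℕ) : Type :=
  {p : Fin (d + 1) × Fin (d + 1) // p.1 ≤ p.2} ⊕ Unit

/-- The upper triangle of a matrix, together with a number. -/
def upperTriangle (d : ℕ) :
    Matrix (Fin (d + 1)) (Fin (d + 1)) ℝ × ℝ →ₗ[ℝ] (ConfigEquation d → ℝ) where
  toFun p := Sum.elim (fun i => p.1 i.1.1 i.1.2) fun _ => p.2
  map_add' p p' := by ext (i | i) <;> rfl
  map_smul' c p := by ext (i | i) <;> rfl

theorem upperTriangle_eq_zero_iff {S : Matrix (Fin (d + 1)) (Fin (d + 1)) ℝ} (hS : Sᵀ = S)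
    (t : ℝ) : upperTriangle d (S, t) = 0 ↔ S = 0 ∧ t = 0 := by
  refine ⟨fun h => ⟨?_, congrFun h (Sum.inr ())⟩, fun h => ?_⟩
  · ext i j
    rcases le_total i j with hij | hij
    · exact congrFun h (Sum.inl ⟨(i, j), hij⟩)
    · rw [← hS]
      exact congrFun h (Sum.inl ⟨(j, i), hij⟩)
  · rw [h.1, h.2]
    exact map_zero _

theorem exists_symm_upperTriangle_eq (c : ConfigEquation d → ℝ) :
    ∃ (S : Matrix (Fin (d + 1)) (Fin (d + 1)) ℝ) (t : ℝ), Sᵀ = S ∧ upperTriangle d (S, t) = c := by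
  refine ⟨Matrix.of fun i j => c (Sum.inl ⟨(min i j, max i j), min_le_max⟩), c (Sum.inr ()), ?_, ?_⟩
  · ext i j
    simp only [Matrix.transpose_apply, Matrix.of_apply, min_comm i j, max_comm i j]
  · ext (⟨⟨i, j⟩, hij⟩ | _)
    · simp only [upperTriangle, LinearMap.coe_mk, AddHom.coe_mk, Sum.elim_inl, Matrix.of_apply]
      congr 3
      exact Prod.ext (min_eq_left hij) (max_eq_right hij)
    · rfl

theorem isEmbeddedSubmanifold_configSpace (d : ℕ) (b : ℝ) :
    IsEmbeddedSubmanifold (configSpace d b) := by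
  -- On the open set `det R > 0` the equation `Rᵀ R = 1` alone forces `det R = 1`. Since `Rᵀ R - 1`
  -- is symmetric, only its upper triangle is kept; the full matrix would not give a submersion.
  refine isEmbeddedSubmanifold_of_submersion (U := {q : Ambient d | 0 < q.1.det})
    (f := fun q => upperTriangle d (q.1ᵀ * q.1 - 1, q.2 (Fin.last d) - b)) ?_ ?_ ?_ ?_ ?_
  · exact isOpen_lt continuous_const (Continuous.matrix_det continuous_fst)
  · intro q hq
    rw [Set.mem_ofPred_eq, (mem_specialOrthogonalGroup_iff_transpose.mp hq.1).2]
    exact one_pos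
  · exact (((contDiffOn_fst.transpose.matrixMul contDiffOn_fst).sub contDiffOn_const).prodMk
      ((contDiffOn_snd.apply _).sub contDiffOn_const)).linear _
  · intro q hq
    rw [upperTriangle_eq_zero_iff (by simp), sub_eq_zero, sub_eq_zero]
    refine ⟨fun h => ⟨transpose_mul_self_of_mem h.1, h.2⟩, fun h => ⟨?_, h.2⟩⟩
    refine mem_specialOrthogonalGroup_iff_transpose.mpr ⟨h.1, ?_⟩
    have h1 := det_sq_eq_one h.1
    have h2 : 0 < q.1.det := hq
    nlinarith
  · intro q hq c
    obtain ⟨S, t, hS, hc⟩ := exists_symm_upperTriangle_eq c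
    -- For `Ṙ = R S / 2` with `S` symmetric, the derivative of `Rᵀ R` is `S / 2 + S / 2 = S`.
    have hid : HasDirDerivWithin (fun y : Ambient d => y) Set.univ q
        ((1 / 2 : ℝ) • (q.1 * S), t • lastVec d) _ := .id
    have h1 := hid.linear (LinearMap.fst ℝ _ _)
    have h2 := hid.linear (LinearMap.snd ℝ _ _)
    have h3 := (((h1.transpose.matrixMul h1).sub (.const 1)).prodMk
      ((h2.apply (Fin.last d)).sub (.const b))).linear (upperTriangle d)
    refine ⟨_, h3.congr_deriv ?_⟩
    rw [← hc]
    congr 2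
    · have h4 := transpose_mul_self_of_mem hq.1
      simp only [LinearMap.fst_apply, sub_zero, Matrix.transpose_smul, Matrix.transpose_mul, hS,
        Matrix.mul_smul, Matrix.smul_mul, ← mul_assoc, h4, one_mul]
      rw [mul_assoc, h4, mul_one, ← add_smul]
      norm_num
    · simp [lastVec_last]

theorem isEmbeddedSubmanifold_unitSphere (d : ℕ) : IsEmbeddedSubmanifold (unitSphere d) := by
  refine isEmbeddedSubmanifold_of_submersion (U := Set.univ) (κ := Unit)
    (f := fun γ _ => γ ⬝ᵥ γ - 1) isOpen_univ (Set.subset_univ _) ?_ ?_ ?_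
  · exact contDiffOn_pi.mpr fun _ => (contDiffOn_id.dotProduct contDiffOn_id).sub contDiffOn_const
  · intro γ _
    simp [unitSphere, funext_iff, sub_eq_zero]
  · intro γ hγ c
    have hid : HasDirDerivWithin (fun y : Fin (d + 1) → ℝ => y) Set.univ γ
      ((c () / 2) • γ) _ := .id
    have h3 := ((hid.dotProduct hid).sub (.const 1)).linear
      (LinearMap.pi fun _ : Unit => LinearMap.id)
    have h4 : γ ⬝ᵥ γ = 1 := hγ
    refine ⟨_, h3.congr_deriv ?_⟩
    ext
    simp [h4]

/-! ### Rank, smoothness and non-integrability of the distribution. -/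

/-- The inclusion of the horizontal vectors. -/
def horizontalInclusion (d : ℕ) : (Fin d → ℝ) →ₗ[ℝ] (Fin (d + 1) → ℝ) where
  toFun c := Fin.snoc (α := fun _ => ℝ) c 0
  map_add' c c' := by ext i; induction i using Fin.lastCases <;> simp
  map_smul' t c := by ext i; induction i using Fin.lastCases <;> simp

/-- `rollVec`, as a linear map in the horizontal vector. -/
def rollLinear (b : ℝ) (q : Ambient d) : (Fin d → ℝ) →ₗ[ℝ] Ambient d where
  toFun c := rollVec b (horizontalInclusion d c) q
  map_add' c c' := by rw [map_add, rollVec_add]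
  map_smul' t c := by rw [map_smul, rollVec_smul, RingHom.id_apply]

theorem horizontalInclusion_last (c : Fin d → ℝ) : horizontalInclusion d c (Fin.last d) = 0 := by
  simp [horizontalInclusion]

theorem horizontalInclusion_castSucc (c : Fin d → ℝ) (i : Fin d) :
    horizontalInclusion d c i.castSucc = c i := by
  simp [horizontalInclusion]

theorem exists_horizontalInclusion_eq {u : Fin (d + 1) → ℝ} (hu : u (Fin.last d) = 0) :
    ∃ c, horizontalInclusion d c = u := by
  refine ⟨fun i => u i.castSucc, ?_⟩
  ext i
  induction i using Fin.lastCases with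
  | last => rw [horizontalInclusion_last, hu]
  | cast i => rw [horizontalInclusion_castSucc]

theorem rollVec_injective {q : Ambient d} (hq : q ∈ configSpace d b) {u w : Fin (d + 1) → ℝ}
    (hu : u (Fin.last d) = 0) (hw : w (Fin.last d) = 0) (h : rollVec b u q = rollVec b w q) :
    u = w := by
  rw [← wedge_lastVec_mulVec hu, ← wedge_lastVec_mulVec hw, ← spaceVel_rollVec hq,
    ← spaceVel_rollVec hq, h]

theorem distribution_eq_range {q : Ambient d} (hq : q ∈ configSpace d b) :
    distribution d b q = LinearMap.range (rollLinear b q) := by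
  ext v
  rw [mem_distribution_iff hq, LinearMap.mem_range]
  constructor
  · rintro ⟨u, hu, rfl⟩
    obtain ⟨c, rfl⟩ := exists_horizontalInclusion_eq hu
    exact ⟨c, rfl⟩
  · rintro ⟨c, rfl⟩
    exact ⟨_, horizontalInclusion_last c, rfl⟩

theorem finrank_distribution {q : Ambient d} (hq : q ∈ configSpace d b) :
    Module.finrank ℝ (distribution d b q) = d := by
  rw [distribution_eq_range hq, LinearMap.finrank_range_of_inj, Module.finrank_fin_fun]
  intro c c' h
  have := rollVec_injective hq (horizontalInclusion_last c) (horizontalInclusion_last c') h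
  ext i
  rw [← horizontalInclusion_castSucc c, this, horizontalInclusion_castSucc]

theorem distribution_eq_span {q : Ambient d} (hq : q ∈ configSpace d b) :
    distribution d b q = Submodule.span ℝ
      (Set.range fun i => rollVec b (horizontalInclusion d (Pi.single i 1)) q) := by
  rw [distribution_eq_range hq, LinearMap.range_eq_map, ← (Pi.basisFun ℝ (Fin d)).span_eq,
    Submodule.map_span, ← Set.range_comp]
  congr 2
  ext1 i
  simp [rollLinear]

theorem contDiffOn_rollVec {s : Set (Ambient d)} {u : Ambient d → Fin (d + 1) → ℝ}
    (hu : ContDiffOn ℝ ∞ u s) : ContDiffOn ℝ ∞ (fun q => rollVec b (u q) q) s := by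
  let L : (Fin (d + 1) → ℝ) →ₗ[ℝ] Matrix (Fin (d + 1)) (Fin (d + 1)) ℝ :=
    ⟨⟨fun u => wedge u (lastVec d), fun _ _ => wedge_add_left _ _ _⟩,
      fun _ _ => wedge_smul_left _ _ _⟩
  exact ((hu.linear L).matrixMul contDiffOn_fst).prodMk (hu.const_smul b)

theorem hasDirDerivWithin_rollVec {s : Set (Ambient d)} {q v : Ambient d}
    {u : Ambient d → Fin (d + 1) → ℝ} {u' : Fin (d + 1) → ℝ} (hu : HasDirDerivWithin u s q v u') :
    HasDirDerivWithin (fun q => rollVec b (u q) q) s q v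
      (wedge (u q) (lastVec d) * v.1 + wedge u' (lastVec d) * q.1, b • u') := by
  let L : (Fin (d + 1) → ℝ) →ₗ[ℝ] Matrix (Fin (d + 1)) (Fin (d + 1)) ℝ :=
    ⟨⟨fun u => wedge u (lastVec d), fun _ _ => wedge_add_left _ _ _⟩,
      fun _ _ => wedge_smul_left _ _ _⟩
  have hid : HasDirDerivWithin (fun y : Ambient d => y) s q v v := .id
  exact ((hu.linear L).matrixMul (hid.linear (LinearMap.fst ℝ _ _))).prodMk (hu.const_smul b)

/-- The bracket of two fields with values in the distribution. -/
theorem lieBracketWithin_rollVec {q : Ambient d} (hq : q ∈ configSpace d b)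
    {u w : Ambient d → Fin (d + 1) → ℝ} {u' w' : Fin (d + 1) → ℝ}
    (hun : u q (Fin.last d) = 0) (hwn : w q (Fin.last d) = 0)
    (hu : HasDirDerivWithin u (configSpace d b) q (rollVec b (w q) q) u')
    (hw : HasDirDerivWithin w (configSpace d b) q (rollVec b (u q) q) w') :
    VectorField.lieBracketWithin ℝ (fun q => rollVec b (u q) q) (fun q => rollVec b (w q) q)
      (configSpace d b) q = rollVec b (w' - u') q + (wedge (u q) (w q) * q.1, 0) := by
  rw [HasDirDerivWithin.lieBracketWithin_eq (X := fun q => rollVec b (u q) q)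
    (Y := fun q => rollVec b (w q) q) (hasDirDerivWithin_rollVec hu) (hasDirDerivWithin_rollVec hw)
    (rollVec_mem_distribution hq hun).1 (rollVec_mem_distribution hq hwn).1]
  refine Prod.ext ?_ ?_
  · simp only [rollVec, Prod.fst_sub, Prod.fst_add, ← Matrix.mul_assoc, wedge_sub_left,
      Matrix.sub_mul]
    -- The derivatives of `u` and `w` give the rolling part. Moving `R` contributes the commutator
    -- of `w ∧ e_n` and `u ∧ e_n`, which is `u ∧ w`.
    rw [← wedge_commutator lastVec_dotProduct_self ((lastVec_dotProduct _).trans hwn)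
      ((lastVec_dotProduct _).trans hun), Matrix.sub_mul]
    abel
  · simp [rollVec, smul_sub]

theorem isSmoothVectorField_rollVec {u : Fin (d + 1) → ℝ} (hu : u (Fin.last d) = 0) :
    IsSmoothVectorField (configSpace d b) (fun q => rollVec b u q) :=
  ⟨contDiffOn_rollVec contDiffOn_const, fun _ hq => (rollVec_mem_distribution hq hu).1⟩

theorem one_mem_configSpace (d : ℕ) (b : ℝ) : ((1, b • lastVec d) : Ambient d) ∈ configSpace d b :=
  ⟨one_mem _, by simp [lastVec_last]⟩

/-- The rolling fields of two distinct horizontal basis vectors have as bracket a pure spin, whose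
`ω_ij` is nonzero. Two such vectors exist because `d ≥ 2`. -/
theorem not_involutive (hd : 2 ≤ d) (b : ℝ) :
    ∃ X Y : Ambient d → Ambient d, IsSmoothVectorField (configSpace d b) X ∧
      IsSmoothVectorField (configSpace d b) Y ∧
      (∀ q ∈ configSpace d b, X q ∈ distribution d b q ∧ Y q ∈ distribution d b q) ∧
      ∃ q ∈ configSpace d b,
        VectorField.lieBracketWithin ℝ X Y (configSpace d b) q ∉ distribution d b q := by
  let i : Fin d := ⟨0, by omega⟩
  let j : Fin d := ⟨1, by omega⟩
  have hij : i ≠ j := by simp [i, j]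
  let u := horizontalInclusion d (Pi.single i 1)
  let w := horizontalInclusion d (Pi.single j 1)
  have hu : u (Fin.last d) = 0 := horizontalInclusion_last _
  have hw : w (Fin.last d) = 0 := horizontalInclusion_last _
  refine ⟨fun q => rollVec b u q, fun q => rollVec b w q, isSmoothVectorField_rollVec hu,
    isSmoothVectorField_rollVec hw,
    fun q hq => ⟨rollVec_mem_distribution hq hu, rollVec_mem_distribution hq hw⟩,
    _, one_mem_configSpace d b, fun h => ?_⟩
  rw [lieBracketWithin_rollVec (one_mem_configSpace d b) hu hw (.const u) (.const w), sub_zero] at h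
  have h2 := h.2.2 i j
  simp [spaceVel, rollVec, wedge_apply, lastVec_castSucc, u, w, horizontalInclusion_castSucc,
    hij, hij.symm] at h2

/-! ### Symmetry, positivity and smoothness of the kinetic energy metric. -/

section Metric

variable {m ℓ J₁ Jₙ : ℝ}

theorem kineticMetric_apply (q v w : Ambient d) :
    kineticMetric d m ℓ J₁ Jₙ q v w =
      killing (inertia d J₁ Jₙ (bodyVel d q v)) (bodyVel d q w) +
      m * (massCentreVel d ℓ q v ⬝ᵥ massCentreVel d ℓ q w) := rfl

theorem killing_inertia_comm (A B : Matrix (Fin (d + 1)) (Fin (d + 1)) ℝ) :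
    killing (inertia d J₁ Jₙ A) B = killing (inertia d J₁ Jₙ B) A := by
  rw [killing, killing, inertia, inertia, Matrix.add_mul, Matrix.add_mul, Matrix.trace_add,
    Matrix.trace_add, Matrix.trace_mul_cycle, Matrix.mul_assoc A, Matrix.trace_mul_comm A]
  ring

theorem kineticMetric_comm (q v w : Ambient d) :
    kineticMetric d m ℓ J₁ Jₙ q v w = kineticMetric d m ℓ J₁ Jₙ q w v := by
  rw [kineticMetric_apply, kineticMetric_apply, killing_inertia_comm, dotProduct_comm]

/-- Both terms of the trace equal `tr(𝕁 A²)`, and `A j i = -A i j` turns this into minus a weighted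
sum of squares. -/
theorem killing_inertia_self {A : Matrix (Fin (d + 1)) (Fin (d + 1)) ℝ} (hA : Aᵀ = -A) :
    killing (inertia d J₁ Jₙ A) A =
      ∑ i, ∑ j, (if i = Fin.last d then Jₙ else J₁) * A i j ^ 2 := by
  have h1 : (A * massTensor d J₁ Jₙ * A).trace = (massTensor d J₁ Jₙ * A * A).trace := by
    rw [Matrix.trace_mul_cycle, Matrix.trace_mul_cycle]
  have h2 : (massTensor d J₁ Jₙ * A * A).trace =
      -∑ i, ∑ j, (if i = Fin.last d then Jₙ else J₁) * A i j ^ 2 := by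
    rw [Matrix.mul_assoc, massTensor, Matrix.trace, ← Finset.sum_neg_distrib]
    refine Finset.sum_congr rfl fun i _ => ?_
    rw [Matrix.diag_apply, Matrix.diagonal_mul, Matrix.mul_apply, Finset.mul_sum,
      ← Finset.sum_neg_distrib]
    refine Finset.sum_congr rfl fun j _ => ?_
    have : A j i = -A i j := congrFun (congrFun hA i) j
    rw [this]
    ring
  rw [killing, inertia, Matrix.add_mul, Matrix.trace_add, h1, h2]
  ring

/-- If `Ω ≠ 0` the rotational energy is already positive. If `Ω = 0` the velocity of the centre of
mass is `Rᵀ ẋ`, which is nonzero because `R` is invertible. -/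
theorem kineticMetric_pos (hm : 0 < m) (hJ₁ : 0 < J₁) (hJₙ : 0 < Jₙ) {q v : Ambient d}
    (hq : q ∈ configSpace d b) (hv : v ∈ tangentSpaceAt (configSpace d b) q) (h0 : v ≠ 0) :
    0 < kineticMetric d m ℓ J₁ Jₙ q v v := by
  have hs := ((mem_tangentSpaceAt_configSpace hq).mp hv).1
  have hJ : ∀ i : Fin (d + 1), 0 < if i = Fin.last d then Jₙ else J₁ := fun i => by
    split_ifs <;> assumption
  rw [kineticMetric_apply, killing_inertia_self hs]
  have h1 : 0 ≤ m * (massCentreVel d ℓ q v ⬝ᵥ massCentreVel d ℓ q v) :=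
    mul_nonneg hm.le (Finset.sum_nonneg fun i _ => mul_self_nonneg _)
  by_cases hA : bodyVel d q v = 0
  · have hv1 : v.1 = 0 := by
      rw [fst_eq_spaceVel_mul hq, spaceVel_eq hq, hA]
      simp
    have hc : massCentreVel d ℓ q v ≠ 0 := by
      intro h
      rw [massCentreVel, hA, Matrix.zero_mulVec, smul_zero, add_zero] at h
      refine h0 (Prod.ext hv1 ?_)
      rw [← Matrix.one_mulVec v.2, ← mul_transpose_self_of_mem hq.1, ← Matrix.mulVec_mulVec, h,
        Matrix.mulVec_zero]
      rfl
    have : 0 < m * (massCentreVel d ℓ q v ⬝ᵥ massCentreVel d ℓ q v) :=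
      mul_pos hm (lt_of_le_of_ne (Finset.sum_nonneg fun i _ => mul_self_nonneg _)
        (Ne.symm (dotProduct_self_eq_zero.not.mpr hc)))
    rw [hA]
    simpa using this
  · obtain ⟨i, hi⟩ := Function.ne_iff.mp hA
    obtain ⟨j, hj⟩ := Function.ne_iff.mp hi
    have hn : ∀ k l : Fin (d + 1),
        0 ≤ (if k = Fin.last d then Jₙ else J₁) * bodyVel d q v k l ^ 2 :=
      fun k l => mul_nonneg (hJ k).le (sq_nonneg _)
    have h2 : 0 < ∑ k, ∑ l, (if k = Fin.last d then Jₙ else J₁) * bodyVel d q v k l ^ 2 := by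
      refine Finset.sum_pos' (fun k _ => Finset.sum_nonneg fun l _ => hn k l)
        ⟨i, Finset.mem_univ i, Finset.sum_pos' (fun l _ => hn i l) ⟨j, Finset.mem_univ j, ?_⟩⟩
      exact mul_pos (hJ i) (lt_of_le_of_ne (sq_nonneg _) (Ne.symm (pow_ne_zero 2 hj)))
    exact add_pos_of_pos_of_nonneg h2 h1

theorem contDiffOn_kineticMetric (s : Set (Ambient d × Ambient d × Ambient d)) :
    ContDiffOn ℝ ∞ (fun p : Ambient d × Ambient d × Ambient d =>
      kineticMetric d m ℓ J₁ Jₙ p.1 p.2.1 p.2.2) s := by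
  have hq : ContDiffOn ℝ ∞ (fun p : Ambient d × Ambient d × Ambient d => p.1) s := contDiffOn_fst
  have hv : ContDiffOn ℝ ∞ (fun p : Ambient d × Ambient d × Ambient d => p.2.1) s :=
    contDiffOn_snd.fst
  have hw : ContDiffOn ℝ ∞ (fun p : Ambient d × Ambient d × Ambient d => p.2.2) s :=
    contDiffOn_snd.snd
  have key : ∀ {z : Ambient d × Ambient d × Ambient d → Ambient d}, ContDiffOn ℝ ∞ z s →
      ContDiffOn ℝ ∞ (fun p => bodyVel d p.1 (z p)) s ∧
        ContDiffOn ℝ ∞ (fun p => massCentreVel d ℓ p.1 (z p)) s := by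
    intro z hz
    have h1 : ContDiffOn ℝ ∞ (fun p => bodyVel d p.1 (z p)) s :=
      hq.fst.transpose.matrixMul hz.fst
    exact ⟨h1, (hq.fst.transpose.mulVec hz.snd).add ((h1.mulVec contDiffOn_const).const_smul ℓ)⟩
  have hA := (key hv).1
  have hB := (key hw).1
  have hI : ContDiffOn ℝ ∞ (fun p : Ambient d × Ambient d × Ambient d =>
      inertia d J₁ Jₙ (bodyVel d p.1 p.2.1)) s :=
    (contDiffOn_const.matrixMul hA).add (hA.matrixMul contDiffOn_const)
  exact (contDiffOn_const.mul (hI.matrixMul hB).trace).add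
    (contDiffOn_const.mul ((key hv).2.dotProduct (key hw).2))

end Metric

theorem contDiffOn_poisson (s : Set (Ambient d)) : ContDiffOn ℝ ∞ (poisson d) s :=
  contDiffOn_fst.transpose.mulVec contDiffOn_const

theorem isNonholonomicSystem_system (hd : 2 ≤ d) {m b ℓ grav J₁ Jₙ : ℝ} (hm : 0 < m)
    (hJ₁ : 0 < J₁) (hJₙ : 0 < Jₙ) : IsNonholonomicSystem (system d m b ℓ grav J₁ Jₙ) d where
  submanifold := isEmbeddedSubmanifold_configSpace d b
  rank_ge := hd
  le_tangent _ _ _ hv := hv.1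
  rank_eq _ hq := finrank_distribution hq
  smooth_distribution q _ := ⟨Set.univ, isOpen_univ, Set.mem_univ q, d,
    fun i => rollVec b (horizontalInclusion d (Pi.single i 1)),
    fun _ => contDiffOn_rollVec contDiffOn_const, fun _ hp => distribution_eq_span hp.1⟩
  nonintegrable := not_involutive hd b
  metric_symm _ _ _ _ _ _ := kineticMetric_comm _ _ _
  metric_pos _ hq _ hv h0 := kineticMetric_pos hm hJ₁ hJₙ hq hv h0
  metric_smooth := contDiffOn_kineticMetric _
  potential_smooth := contDiffOn_const.mul ((contDiffOn_poisson _).apply (Fin.last d))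

end RouthSphere

namespace RouthSphere

variable {d : ℕ} {b : ℝ}

/-! ### The group `SE(n - 1)`, its action and the vertical spaces. -/

section Group

theorem mem_matrixSet_specialEuclidean
    {M : Matrix (Fin (d + 1) ⊕ Unit) (Fin (d + 1) ⊕ Unit) ℝ} :
    M ∈ matrixSet (specialEuclidean d) ↔
      ∃ h y, IsHorizontalRotation h ∧ y (Fin.last d) = 0 ∧ M = seMatrix h y := by
  constructor
  · rintro ⟨g, ⟨h, y, hh, hy, hg⟩, rfl⟩
    exact ⟨h, y, hh, hy, hg⟩
  · rintro ⟨h, y, hh, hy, rfl⟩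
    have h1 := transpose_mul_self_of_mem hh.1
    have h2 := mul_transpose_self_of_mem hh.1
    refine ⟨⟨seMatrix h y, seMatrix hᵀ (-(hᵀ *ᵥ y)), ?_, ?_⟩, ⟨h, y, hh, hy, rfl⟩, rfl⟩
    · rw [seMatrix_mul, h2, Matrix.mulVec_neg, Matrix.mulVec_mulVec, h2, Matrix.one_mulVec,
        neg_add_cancel, seMatrix_one]
    · rw [seMatrix_mul, h1, add_neg_cancel, seMatrix_one]

theorem seAction_seMatrix (h : Matrix (Fin (d + 1)) (Fin (d + 1)) ℝ) (y : Fin (d + 1) → ℝ)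
    (q : Ambient d) : seAction d (seMatrix h y) q = (h * q.1, h *ᵥ q.2 + y) := by
  simp only [seAction, seMatrix, Matrix.toBlocks_fromBlocks₁₁]
  rfl

theorem IsHorizontalRotation.transpose_mulVec {h : Matrix (Fin (d + 1)) (Fin (d + 1)) ℝ}
    (hh : IsHorizontalRotation h) : hᵀ *ᵥ lastVec d = lastVec d := by
  conv_lhs => rw [← hh.2, Matrix.mulVec_mulVec, transpose_mul_self_of_mem hh.1, Matrix.one_mulVec]

theorem seAction_mem {h : Matrix (Fin (d + 1)) (Fin (d + 1)) ℝ} {y : Fin (d + 1) → ℝ}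
    {q : Ambient d} (hh : IsHorizontalRotation h) (hy : y (Fin.last d) = 0)
    (hq : q ∈ configSpace d b) : seAction d (seMatrix h y) q ∈ configSpace d b := by
  rw [seAction_seMatrix]
  refine ⟨mul_mem hh.1 hq.1, ?_⟩
  change (h *ᵥ q.2 + y) (Fin.last d) = b
  rw [Pi.add_apply, mulVec_last hh.1 hh.2, hy, add_zero, hq.2]

theorem poisson_seAction {h : Matrix (Fin (d + 1)) (Fin (d + 1)) ℝ} (hh : IsHorizontalRotation h)
    (y : Fin (d + 1) → ℝ) (q : Ambient d) :
    poisson d (seAction d (seMatrix h y) q) = poisson d q := by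
  rw [seAction_seMatrix, poisson, Matrix.transpose_mul, ← Matrix.mulVec_mulVec,
    hh.transpose_mulVec, poisson]

/-- The upper left block, as a linear map. -/
def rotationBlock (d : ℕ) : Matrix (Fin (d + 1) ⊕ Unit) (Fin (d + 1) ⊕ Unit) ℝ →ₗ[ℝ]
    Matrix (Fin (d + 1)) (Fin (d + 1)) ℝ where
  toFun M := M.toBlocks₁₁
  map_add' _ _ := rfl
  map_smul' _ _ := rfl

/-- The last column, as a linear map. -/
def translationBlock (d : ℕ) : Matrix (Fin (d + 1) ⊕ Unit) (Fin (d + 1) ⊕ Unit) ℝ →ₗ[ℝ]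
    (Fin (d + 1) → ℝ) where
  toFun M i := M (Sum.inl i) (Sum.inr ())
  map_add' _ _ := rfl
  map_smul' _ _ := rfl

/-- The last row, as a linear map. -/
def lastRow (d : ℕ) : Matrix (Fin (d + 1) ⊕ Unit) (Fin (d + 1) ⊕ Unit) ℝ →ₗ[ℝ]
    ((Fin (d + 1) ⊕ Unit) → ℝ) where
  toFun M := M (Sum.inr ())
  map_add' _ _ := rfl
  map_smul' _ _ := rfl

theorem isClosed_specialOrthogonalGroup :
    IsClosed {R : Matrix (Fin (d + 1)) (Fin (d + 1)) ℝ |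
      R ∈ Matrix.specialOrthogonalGroup (Fin (d + 1)) ℝ} := by
  simp only [mem_specialOrthogonalGroup_iff_transpose]
  exact (isClosed_eq (continuous_id.matrix_transpose.matrix_mul continuous_id)
    continuous_const).inter (isClosed_eq continuous_id.matrix_det continuous_const)

theorem isClosed_specialEuclidean :
    IsClosed (specialEuclidean d : Set (GL (Fin (d + 1) ⊕ Unit) ℝ)) := by
  have h1 : (specialEuclidean d : Set (GL (Fin (d + 1) ⊕ Unit) ℝ)) =
      (fun g : GL (Fin (d + 1) ⊕ Unit) ℝ =>
        (g : Matrix (Fin (d + 1) ⊕ Unit) (Fin (d + 1) ⊕ Unit) ℝ)) ⁻¹'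
      ({M | M.toBlocks₁₁ ∈ Matrix.specialOrthogonalGroup (Fin (d + 1)) ℝ} ∩
        ({M | M.toBlocks₁₁ *ᵥ lastVec d = lastVec d} ∩
          ({M | M (Sum.inl (Fin.last d)) (Sum.inr ()) = 0} ∩
            ({M | M.toBlocks₂₁ = 0} ∩ {M | M.toBlocks₂₂ = 1})))) := by
    ext g
    constructor
    · rintro ⟨h, y, hh, hy, hg⟩
      refine ⟨?_, ?_, ?_, ?_, ?_⟩ <;>
        simp only [Set.mem_ofPred_eq, hg, seMatrix, Matrix.toBlocks_fromBlocks₁₁,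
          Matrix.toBlocks_fromBlocks₂₁, Matrix.toBlocks_fromBlocks₂₂]
      · exact hh.1
      · exact hh.2
      · exact hy
    · rintro ⟨g1, g2, g3, g4, g5⟩
      refine ⟨_, translationBlock d g, ⟨g1, g2⟩, g3, ?_⟩
      refine (Matrix.fromBlocks_toBlocks
        (g : Matrix (Fin (d + 1) ⊕ Unit) (Fin (d + 1) ⊕ Unit) ℝ)).symm.trans ?_
      simp only [Set.mem_ofPred_eq] at g4 g5
      rw [g4, g5]
      rfl
  have hb : Continuous fun M : Matrix (Fin (d + 1) ⊕ Unit) (Fin (d + 1) ⊕ Unit) ℝ =>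
      M.toBlocks₁₁ := continuous_id.matrix_submatrix Sum.inl Sum.inl
  rw [h1]
  refine IsClosed.preimage Units.continuous_val ?_
  refine (isClosed_specialOrthogonalGroup.preimage hb).inter (.inter ?_ (.inter ?_ (.inter ?_ ?_)))
  · exact isClosed_eq (hb.matrix_mulVec continuous_const) continuous_const
  · exact isClosed_eq (continuous_id.matrix_elem _ _) continuous_const
  · exact isClosed_eq (continuous_id.matrix_submatrix Sum.inr Sum.inl) continuous_const
  · exact isClosed_eq (continuous_id.matrix_submatrix Sum.inr Sum.inr) continuous_const

/-- The infinitesimal action at `q`, extended linearly to all matrices. -/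
def seActionLinear (q : Ambient d) :
    Matrix (Fin (d + 1) ⊕ Unit) (Fin (d + 1) ⊕ Unit) ℝ →ₗ[ℝ] Ambient d where
  toFun M := seAction d M q
  map_add' M M' := by
    refine Prod.ext ?_ ?_
    · exact Matrix.add_mul M.toBlocks₁₁ M'.toBlocks₁₁ q.1
    · ext i
      have := congrFun (Matrix.add_mulVec M.toBlocks₁₁ M'.toBlocks₁₁ q.2) i
      change ((M.toBlocks₁₁ + M'.toBlocks₁₁) *ᵥ q.2) i + (M + M') _ _ = _
      rw [this, Matrix.add_apply]
      simp only [seAction, Prod.snd_add, Pi.add_apply]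
      ring
  map_smul' c M := by
    refine Prod.ext ?_ ?_
    · exact Matrix.smul_mul c M.toBlocks₁₁ q.1
    · ext i
      have := congrFun (Matrix.smul_mulVec c M.toBlocks₁₁ q.2) i
      change ((c • M.toBlocks₁₁) *ᵥ q.2) i + (c • M) _ _ = _
      rw [this, Matrix.smul_apply]
      simp only [seAction, Prod.smul_snd, Pi.add_apply, Pi.smul_apply, RingHom.id_apply, smul_add]

theorem isFreeProperSmoothAction_seAction (d : ℕ) (b : ℝ) :
    IsFreeProperSmoothAction (specialEuclidean d) (seAction d) (configSpace d b) where
  closed_subgroup := isClosed_specialEuclidean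
  mapsTo g hg q hq := by
    obtain ⟨h, y, hh, hy, rfl⟩ := mem_matrixSet_specialEuclidean.mp hg
    exact seAction_mem hh hy hq
  one_act q _ := by
    rw [← seMatrix_one, seAction_seMatrix, one_mul, Matrix.one_mulVec, add_zero]
  mul_act g hg g' hg' q _ := by
    obtain ⟨h, y, -, -, rfl⟩ := mem_matrixSet_specialEuclidean.mp hg
    obtain ⟨h', y', -, -, rfl⟩ := mem_matrixSet_specialEuclidean.mp hg'
    rw [seMatrix_mul, seAction_seMatrix, seAction_seMatrix, seAction_seMatrix, mul_assoc,
      Matrix.mulVec_add, Matrix.mulVec_mulVec, add_assoc]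
  smooth := by
    have h1 : ContDiffOn ℝ ∞ (fun p : Matrix (Fin (d + 1) ⊕ Unit) (Fin (d + 1) ⊕ Unit) ℝ ×
        Ambient d => rotationBlock d p.1) (matrixSet (specialEuclidean d) ×ˢ configSpace d b) :=
      contDiffOn_fst.linear _
    exact (h1.matrixMul contDiffOn_snd.fst).prodMk
      ((h1.mulVec contDiffOn_snd.snd).add (contDiffOn_fst.linear (translationBlock d)))
  free g hg q hq hfix := by
    obtain ⟨h, y, -, -, rfl⟩ := mem_matrixSet_specialEuclidean.mp hg
    rw [seAction_seMatrix] at hfix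
    have h1 : h = 1 := by
      have := congrArg (fun A => A * q.1ᵀ) (congrArg Prod.fst hfix)
      simpa [mul_assoc, mul_transpose_self_of_mem hq.1] using this
    have h2 : y = 0 := by
      have := congrArg Prod.snd hfix
      simpa [h1] using this
    rw [h1, h2, seMatrix_one]
  proper K hKQ hK := by
    -- By freeness the group element carrying `q` to `p` is a continuous function `f` of `(q, p)`.
    -- The set to be shown compact is the image under `f` of the pairs in `K × K` with equal Poisson
    -- vectors, a closed condition.
    let f : Ambient d × Ambient d → Matrix (Fin (d + 1) ⊕ Unit) (Fin (d + 1) ⊕ Unit) ℝ :=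
      fun p => seMatrix (p.2.1 * p.1.1ᵀ) (p.2.2 - (p.2.1 * p.1.1ᵀ) *ᵥ p.1.2)
    have hf : Continuous f := by
      have h1 : Continuous fun p : Ambient d × Ambient d => p.2.1 * p.1.1ᵀ :=
        (continuous_fst.comp continuous_snd).matrix_mul
          (continuous_fst.comp continuous_fst).matrix_transpose
      refine h1.matrix_fromBlocks (Continuous.matrix_replicateCol ?_) continuous_const
        continuous_const
      exact (continuous_snd.comp continuous_snd).sub
        (h1.matrix_mulVec (continuous_snd.comp continuous_fst))
    have hπ : Continuous (poisson d) :=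
      (continuous_fst.matrix_transpose).matrix_mulVec continuous_const
    have hc : IsCompact ((K ×ˢ K) ∩ {p | poisson d p.1 = poisson d p.2}) :=
      (hK.prod hK).inter_right
        (isClosed_eq (hπ.comp continuous_fst) (hπ.comp continuous_snd))
    convert hc.image hf using 1
    ext g
    constructor
    · rintro ⟨hg, q, hq, hgq⟩
      obtain ⟨h, y, hh, hy, rfl⟩ := mem_matrixSet_specialEuclidean.mp hg
      refine ⟨(q, seAction d (seMatrix h y) q), ⟨⟨hq, hgq⟩, (poisson_seAction hh y q).symm⟩, ?_⟩
      simp only [f, seAction_seMatrix, mul_assoc, mul_transpose_self_of_mem (hKQ hq).1, mul_one,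
        add_sub_cancel_left]
    · rintro ⟨⟨q, p⟩, ⟨⟨hq, hp⟩, hqp⟩, rfl⟩
      have hhr : IsHorizontalRotation (p.1 * q.1ᵀ) := by
        refine ⟨mul_mem (hKQ hp).1 (transpose_mem (hKQ hq).1), ?_⟩
        rw [← Matrix.mulVec_mulVec]
        exact (congrArg (p.1 *ᵥ ·) hqp).trans (mulVec_poisson (hKQ hp))
      refine ⟨mem_matrixSet_specialEuclidean.mpr ⟨_, _, hhr, ?_, rfl⟩, q, hq, ?_⟩
      · rw [Pi.sub_apply, mulVec_last hhr.1 hhr.2, (hKQ hp).2, (hKQ hq).2, sub_self]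
      · simp only [f, seAction_seMatrix, mul_assoc, transpose_mul_self_of_mem (hKQ hq).1, mul_one,
          add_sub_cancel]
        exact hp

/-- The equations come from differentiating those of the group. The converse uses the curve with
rotation `exp(t ξ)` and translation `t y`; the exponential fixes `e_n` because `ξ e_n = 0`. -/
theorem mem_tangentSpaceAt_specialEuclidean
    {V : Matrix (Fin (d + 1) ⊕ Unit) (Fin (d + 1) ⊕ Unit) ℝ} :
    V ∈ tangentSpaceAt (matrixSet (specialEuclidean d)) 1 ↔
      ∃ ξ y, ξᵀ = -ξ ∧ ξ *ᵥ lastVec d = 0 ∧ y (Fin.last d) = 0 ∧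
        V = Matrix.fromBlocks ξ (Matrix.replicateCol Unit y) 0 0 := by
  have hone : (1 : Matrix (Fin (d + 1) ⊕ Unit) (Fin (d + 1) ⊕ Unit) ℝ) ∈
      matrixSet (specialEuclidean d) := ⟨1, one_mem _, rfl⟩
  constructor
  · intro hV
    have hid : HasDirDerivWithin
      (fun M : Matrix (Fin (d + 1) ⊕ Unit) (Fin (d + 1) ⊕ Unit) ℝ => M)
      (matrixSet (specialEuclidean d)) 1 V V := .id
    have h1 := hid.linear (rotationBlock d)
    have hr1 : rotationBlock d 1 = 1 := by
      rw [← seMatrix_one]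
      exact Matrix.toBlocks_fromBlocks₁₁ _ _ _ _
    have h2 := (h1.transpose.matrixMul h1).of_const (c := 1) (fun M hM => by
      obtain ⟨h, y, hh, hy, rfl⟩ := mem_matrixSet_specialEuclidean.mp hM
      exact transpose_mul_self_of_mem hh.1) hone hV
    have h3 := (h1.mulVec (.const (lastVec d))).of_const (c := lastVec d) (fun M hM => by
      obtain ⟨h, y, hh, hy, rfl⟩ := mem_matrixSet_specialEuclidean.mp hM
      exact hh.2) hone hV
    have h4 := ((hid.linear (translationBlock d)).apply (Fin.last d)).of_const (c := 0)
      (fun M hM => by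
        obtain ⟨h, y, hh, hy, rfl⟩ := mem_matrixSet_specialEuclidean.mp hM
        exact hy) hone hV
    -- All matrices `seMatrix h y` share their last row; `seMatrix 0 0` merely names it.
    have h5 := (hid.linear (lastRow d)).of_const (c := lastRow d (seMatrix 0 0)) (fun M hM => by
      obtain ⟨h, y, hh, hy, rfl⟩ := mem_matrixSet_specialEuclidean.mp hM
      rfl) hone hV
    rw [hr1, Matrix.transpose_one, one_mul, mul_one] at h2
    rw [Matrix.mulVec_zero, zero_add] at h3
    refine ⟨rotationBlock d V, translationBlock d V, eq_neg_of_add_eq_zero_right h2, h3, h4, ?_⟩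
    ext (i | i) (j | j)
    · rfl
    · rfl
    · exact congrFun h5 (Sum.inl j)
    · exact congrFun h5 (Sum.inr j)
  · rintro ⟨ξ, y, hξ, hξe, hy, rfl⟩
    let L : Matrix (Fin (d + 1)) (Fin (d + 1)) ℝ × (Fin (d + 1) → ℝ) →ₗ[ℝ]
        Matrix (Fin (d + 1) ⊕ Unit) (Fin (d + 1) ⊕ Unit) ℝ :=
      { toFun := fun p => Matrix.fromBlocks p.1 (Matrix.replicateCol Unit p.2) 0 0
        map_add' := fun p p' => by ext (i | i) (j | j) <;> simp
        map_smul' := fun c p => by ext (i | i) (j | j) <;> simp }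
    -- `seMatrix` is affine in `(h, z)`, so the curve is a linear image of `(exp(t ξ), t y)` plus a
    -- constant.
    have hs : ∀ h z, seMatrix h z = L (h, z) + Matrix.fromBlocks 0 0 0 1 := fun h z => by
      ext (i | i) (j | j) <;> simp [seMatrix, L]
    have hc : HasDerivAt (fun t : ℝ => (NormedSpace.exp (t • ξ), t • y)) (ξ, y) 0 := by
      refine (hasDerivAt_exp_smul_zero ξ).prodMk ?_
      simpa using (hasDerivAt_id (0 : ℝ)).smul_const y
    have hc2 := ((LinearMap.toContinuousLinearMap L).hasFDerivAt.comp_hasDerivAt (0 : ℝ)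
      hc).add_const (Matrix.fromBlocks 0 0 0 1)
    have h3 := mem_tangentSpaceAt_of_curve (s := matrixSet (specialEuclidean d)) hc2 fun t => ?_
    · simp only [Function.comp_apply, LinearMap.coe_toContinuousLinearMap', zero_smul,
        NormedSpace.exp_zero] at h3
      rwa [← hs, seMatrix_one] at h3
    · simp only [Function.comp_apply, LinearMap.coe_toContinuousLinearMap']
      rw [← hs]
      refine mem_matrixSet_specialEuclidean.mpr ⟨_, _, ⟨exp_mem_specialOrthogonalGroup ?_,
        exp_mulVec_eq_self ?_⟩, ?_, rfl⟩
      · rw [Matrix.transpose_smul, hξ, smul_neg]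
      · rw [Matrix.smul_mulVec, hξe, smul_zero]
      · rw [Pi.smul_apply, hy, smul_zero]

/-- For fixed `q` the formula for the action is linear in the matrix, so it is its own derivative.
-/
theorem fderivWithin_seAction_one {q : Ambient d}
    {V : Matrix (Fin (d + 1) ⊕ Unit) (Fin (d + 1) ⊕ Unit) ℝ}
    (hV : V ∈ tangentSpaceAt (matrixSet (specialEuclidean d)) 1) :
    fderivWithin ℝ (fun g => seAction d g q) (matrixSet (specialEuclidean d)) 1 V =
      seAction d V q := by
  have hid : HasDirDerivWithin
    (fun M : Matrix (Fin (d + 1) ⊕ Unit) (Fin (d + 1) ⊕ Unit) ℝ => M)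
    (matrixSet (specialEuclidean d)) 1 V V := .id
  exact (hid.linear (seActionLinear q)).fderivWithin_apply hV

theorem mem_orbitTangent_iff {q v : Ambient d} :
    v ∈ orbitTangent (specialEuclidean d) (seAction d) q ↔
      ∃ ξ y, ξᵀ = -ξ ∧ ξ *ᵥ lastVec d = 0 ∧ y (Fin.last d) = 0 ∧
        v = (ξ * q.1, ξ *ᵥ q.2 + y) := by
  have key : ∀ ξ y, seAction d (Matrix.fromBlocks ξ (Matrix.replicateCol Unit y) 0 0) q =
      (ξ * q.1, ξ *ᵥ q.2 + y) := fun ξ y => by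
    simp only [seAction, Matrix.toBlocks_fromBlocks₁₁]
    rfl
  rw [orbitTangent, Submodule.mem_map]
  constructor
  · rintro ⟨V, hV, rfl⟩
    obtain ⟨ξ, y, hξ, hξe, hy, rfl⟩ := mem_tangentSpaceAt_specialEuclidean.mp hV
    exact ⟨ξ, y, hξ, hξe, hy, (fderivWithin_seAction_one hV).trans (key ξ y)⟩
  · rintro ⟨ξ, y, hξ, hξe, hy, rfl⟩
    have hV := mem_tangentSpaceAt_specialEuclidean.mpr ⟨ξ, y, hξ, hξe, hy, rfl⟩
    exact ⟨_, hV, (fderivWithin_seAction_one hV).trans (key ξ y)⟩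

/-- The action is infinitesimally free: `ξ R = 0` forces `ξ = 0`, and then `y = 0`. -/
theorem finrank_orbitTangent {q : Ambient d} (hq : q ∈ configSpace d b) :
    Module.finrank ℝ (orbitTangent (specialEuclidean d) (seAction d) q) =
      Module.finrank ℝ (tangentSpaceAt (matrixSet (specialEuclidean d)) 1) := by
  rw [orbitTangent, ← LinearMap.range_domRestrict, LinearMap.finrank_range_of_inj]
  rw [← LinearMap.ker_eq_bot, LinearMap.ker_eq_bot']
  rintro ⟨V, hV⟩ h0
  have h1 := (fderivWithin_seAction_one (q := q) hV).symm.trans h0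
  obtain ⟨ξ, y, hξ, hξe, hy, rfl⟩ := mem_tangentSpaceAt_specialEuclidean.mp hV
  simp only [seAction, Matrix.toBlocks_fromBlocks₁₁] at h1
  have h2 : ξ = 0 := by
    have := congrArg (fun A => A * q.1ᵀ) (congrArg Prod.fst h1)
    simpa [mul_assoc, mul_transpose_self_of_mem hq.1] using this
  have h3 : y = 0 := by
    have := congrArg Prod.snd h1
    simpa [h2] using this
  refine Subtype.ext ?_
  simp [h2, h3]

/-- With `u = ω e_n`, which is horizontal by skewness, `ω - u ∧ e_n` annihilates `e_n` and is an
infinitesimal symmetry. The translation part absorbs what is left of `ẋ`. -/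
theorem orbitTangent_sup_distribution {q : Ambient d} (hq : q ∈ configSpace d b) :
    orbitTangent (specialEuclidean d) (seAction d) q ⊔ distribution d b q =
      tangentSpaceAt (configSpace d b) q := by
  refine le_antisymm (sup_le ?_ fun v hv => hv.1) fun v hv => ?_
  · intro v hv
    obtain ⟨ξ, y, hξ, hξe, hy, rfl⟩ := mem_orbitTangent_iff.mp hv
    refine (mem_tangentSpaceAt_configSpace' hq).mpr ⟨?_, ?_⟩
    · simp only [spaceVel, mul_assoc, mul_transpose_self_of_mem hq.1, mul_one, hξ]
    · change (ξ *ᵥ q.2 + y) (Fin.last d) = 0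
      rw [Pi.add_apply, hy, add_zero, ← lastVec_dotProduct (ξ *ᵥ q.2), Matrix.dotProduct_mulVec,
        ← Matrix.mulVec_transpose, hξ, Matrix.neg_mulVec, hξe, neg_zero, zero_dotProduct]
  · obtain ⟨hs, hn⟩ := (mem_tangentSpaceAt_configSpace' hq).mp hv
    have hu : (spaceVel d q v *ᵥ lastVec d) (Fin.last d) = 0 := by
      have := congrFun (congrFun hs (Fin.last d)) (Fin.last d)
      simp only [Matrix.transpose_apply, Matrix.neg_apply] at this
      simp only [lastVec, Matrix.mulVec_single_one, Matrix.col_apply]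
      linarith
    generalize hud : spaceVel d q v *ᵥ lastVec d = u at hu
    have hξ : (spaceVel d q v - wedge u (lastVec d))ᵀ =
        -(spaceVel d q v - wedge u (lastVec d)) := by
      rw [Matrix.transpose_sub, hs, wedge_transpose]
      abel
    have hξe : (spaceVel d q v - wedge u (lastVec d)) *ᵥ lastVec d = 0 := by
      rw [Matrix.sub_mulVec, hud, wedge_lastVec_mulVec hu, sub_self]
    refine Submodule.mem_sup.mpr ⟨_, mem_orbitTangent_iff.mpr ⟨_, v.2 - b • u -
      (spaceVel d q v - wedge u (lastVec d)) *ᵥ q.2, hξ, hξe, ?_, rfl⟩, _,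
      rollVec_mem_distribution hq hu, ?_⟩
    · rw [Pi.sub_apply, ← lastVec_dotProduct (_ *ᵥ q.2), Matrix.dotProduct_mulVec,
        ← Matrix.mulVec_transpose, hξ, Matrix.neg_mulVec, hξe]
      simp [hn, hu]
    · refine Prod.ext ?_ ?_
      · simp only [rollVec, Prod.fst_add]
        rw [← Matrix.add_mul, sub_add_cancel, ← fst_eq_spaceVel_mul hq]
      · simp [rollVec]

/-- A common vector has `u ∧ e_n = ξ`; applying both sides to `e_n` gives `u = 0`. -/
theorem orbitTangent_inf_distribution {q : Ambient d} (hq : q ∈ configSpace d b) :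
    orbitTangent (specialEuclidean d) (seAction d) q ⊓ distribution d b q = ⊥ := by
  rw [Submodule.eq_bot_iff]
  rintro v ⟨hv, hvD⟩
  obtain ⟨ξ, y, hξ, hξe, hy, hve⟩ := mem_orbitTangent_iff.mp hv
  obtain ⟨u, hu, rfl⟩ := (mem_distribution_iff hq).mp hvD
  have h1 : wedge u (lastVec d) = ξ := by
    rw [← spaceVel_rollVec hq, hve]
    simp only [spaceVel, mul_assoc, mul_transpose_self_of_mem hq.1, mul_one]
  have h2 : u = 0 := by rw [← wedge_lastVec_mulVec hu, h1, hξe]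
  have := rollVec_smul b 0 u q
  rwa [zero_smul, zero_smul, ← h2] at this

end Group

/-! ### Invariance of the metric, potential and distribution. -/

section Invariance

theorem fderivWithin_seAction {q v : Ambient d} {h : Matrix (Fin (d + 1)) (Fin (d + 1)) ℝ}
    {y : Fin (d + 1) → ℝ} (hv : v ∈ tangentSpaceAt (configSpace d b) q) :
    fderivWithin ℝ (seAction d (seMatrix h y)) (configSpace d b) q v = (h * v.1, h *ᵥ v.2) := by
  have hid : HasDirDerivWithin (fun y : Ambient d => y) (configSpace d b) q v v := .id
  have h1 := ((HasDirDerivWithin.const h).matrixMul (hid.linear (LinearMap.fst ℝ _ _))).prodMk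
    (((HasDirDerivWithin.const h).mulVec (hid.linear (LinearMap.snd ℝ _ _))).sub (.const (-y)))
  have h2 : HasDirDerivWithin (seAction d (seMatrix h y)) (configSpace d b) q v
      (h * v.1, h *ᵥ v.2) := by
    have h3 : seAction d (seMatrix h y) = fun p => (h * p.1, h *ᵥ p.2 - -y) := by
      ext1 p
      rw [seAction_seMatrix, sub_neg_eq_add]
    rw [h3]
    exact h1.congr_deriv (by simp)
  exact h2.fderivWithin_apply hv

theorem isChaplyginSystem_system (hd : 2 ≤ d) {m b ℓ grav J₁ Jₙ : ℝ} (hm : 0 < m)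
    (hJ₁ : 0 < J₁) (hJₙ : 0 < Jₙ) :
    IsChaplyginSystem (system d m b ℓ grav J₁ Jₙ) d (specialEuclidean d) (seAction d) where
  nonholonomic := isNonholonomicSystem_system hd hm hJ₁ hJₙ
  action := isFreeProperSmoothAction_seAction d b
  dim_group q hq := by
    -- The dimension count follows from the direct sum decomposition, without computing the
    -- dimension of either manifold.
    have h1 := Submodule.finrank_sup_add_finrank_inf_eq
      (orbitTangent (specialEuclidean d) (seAction d) q) (distribution d b q)
    rw [orbitTangent_sup_distribution hq, orbitTangent_inf_distribution hq, finrank_bot, add_zero,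
      finrank_orbitTangent hq, finrank_distribution hq] at h1
    exact h1.symm
  isometry g hg q _ v hv w hw := by
    obtain ⟨h, y, hh, hy, rfl⟩ := mem_matrixSet_specialEuclidean.mp hg
    -- The group multiplies `R`, `Ṙ` and `ẋ` by `h` on the left, so the body-frame quantities `Rᵀ Ṙ`
    -- and `Rᵀ ẋ` do not change.
    have key : ∀ z ∈ tangentSpaceAt (configSpace d b) q,
        bodyVel d (seAction d (seMatrix h y) q)
          (fderivWithin ℝ (seAction d (seMatrix h y)) (configSpace d b) q z) = bodyVel d q z ∧
        massCentreVel d ℓ (seAction d (seMatrix h y) q)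
          (fderivWithin ℝ (seAction d (seMatrix h y)) (configSpace d b) q z) =
            massCentreVel d ℓ q z := by
      intro z hz
      have h1 : bodyVel d (seAction d (seMatrix h y) q)
          (fderivWithin ℝ (seAction d (seMatrix h y)) (configSpace d b) q z) = bodyVel d q z := by
        rw [fderivWithin_seAction hz, seAction_seMatrix, bodyVel, Matrix.transpose_mul, mul_assoc,
          ← mul_assoc hᵀ, transpose_mul_self_of_mem hh.1, one_mul, bodyVel]
      refine ⟨h1, ?_⟩
      rw [massCentreVel, h1, fderivWithin_seAction hz, seAction_seMatrix, Matrix.transpose_mul,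
        Matrix.mulVec_mulVec, mul_assoc, transpose_mul_self_of_mem hh.1, mul_one, massCentreVel]
    change kineticMetric d m ℓ J₁ Jₙ _ _ _ = kineticMetric d m ℓ J₁ Jₙ _ _ _
    rw [kineticMetric_apply, kineticMetric_apply]
    exact congrArg₂ _
      (congrArg₂ (fun A B => killing (inertia d J₁ Jₙ A) B) (key v hv).1 (key w hw).1)
      (congrArg₂ (fun A B => m * (A ⬝ᵥ B)) (key v hv).2 (key w hw).2)
  potential_invariant g hg q _ := by
    obtain ⟨h, y, hh, hy, rfl⟩ := mem_matrixSet_specialEuclidean.mp hg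
    simp only [system, poisson_seAction hh]
  distribution_invariant g hg q hq := by
    obtain ⟨h, y, hh, hy, rfl⟩ := mem_matrixSet_specialEuclidean.mp hg
    -- Since `h (u ∧ e_n) hᵀ = (h u) ∧ e_n`, the group acts on the parameter of the distribution by
    -- `u ↦ h u`.
    have hroll : ∀ u : Fin (d + 1) → ℝ, u (Fin.last d) = 0 →
        fderivWithin ℝ (seAction d (seMatrix h y)) (configSpace d b) q (rollVec b u q) =
          rollVec b (h *ᵥ u) (seAction d (seMatrix h y) q) := by
      intro u hu
      have h1 := mul_wedge_mul_transpose h u (lastVec d)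
      rw [hh.2] at h1
      rw [fderivWithin_seAction (rollVec_mem_distribution hq hu).1, seAction_seMatrix, rollVec,
        rollVec, ← h1, Matrix.mulVec_smul, mul_assoc (h * _), ← mul_assoc hᵀ,
        transpose_mul_self_of_mem hh.1, one_mul, mul_assoc]
    ext v
    rw [Submodule.mem_map]
    refine (mem_distribution_iff (seAction_mem hh hy hq)).trans ⟨?_, ?_⟩
    · rintro ⟨u, hu, rfl⟩
      have hu' : (hᵀ *ᵥ u) (Fin.last d) = 0 := by
        rw [mulVec_last (transpose_mem hh.1) hh.transpose_mulVec, hu]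
      refine ⟨_, rollVec_mem_distribution hq hu', (hroll _ hu').trans ?_⟩
      rw [Matrix.mulVec_mulVec, mul_transpose_self_of_mem hh.1, Matrix.one_mulVec]
    · rintro ⟨w, hw, rfl⟩
      obtain ⟨u, hu, rfl⟩ := (mem_distribution_iff hq).mp hw
      exact ⟨h *ᵥ u, by rw [mulVec_last hh.1 hh.2, hu], hroll u hu⟩
  splitting_sup _ hq := orbitTangent_sup_distribution hq
  splitting_inf _ hq := orbitTangent_inf_distribution hq

end Invariance

/-! ### The sphere as orbit space. -/

section ShapeSpace

/-- The Householder reflection along `w = γ - e_n` exchanges `e_n` and `γ`, because `w · w = -2 (w ·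
e_n)` for unit vectors. It degenerates when `γ = e_n`, where the identity serves. -/
theorem exists_orthogonal_transpose_mulVec_eq {γ : Fin (d + 1) → ℝ} (hγ : γ ⬝ᵥ γ = 1) :
    ∃ H : Matrix (Fin (d + 1)) (Fin (d + 1)) ℝ, Hᵀ * H = 1 ∧ Hᵀ *ᵥ lastVec d = γ := by
  by_cases h : γ = lastVec d
  · exact ⟨1, by simp, by simp [h]⟩
  have hw : (γ - lastVec d) ⬝ᵥ (γ - lastVec d) ≠ 0 :=
    dotProduct_self_eq_zero.not.mpr (sub_ne_zero.mpr h)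
  have hwe : (γ - lastVec d) ⬝ᵥ (γ - lastVec d) = -2 * ((γ - lastVec d) ⬝ᵥ lastVec d) := by
    simp only [sub_dotProduct, dotProduct_sub, hγ, lastVec_dotProduct_self,
      dotProduct_comm (lastVec d) γ]
    ring
  generalize hwd : γ - lastVec d = w at hw hwe
  have ht : (1 - (2 / (w ⬝ᵥ w)) • Matrix.vecMulVec w w)ᵀ =
      1 - (2 / (w ⬝ᵥ w)) • Matrix.vecMulVec w w := by
    simp [Matrix.transpose_vecMulVec]
  have hv : Matrix.vecMulVec w w * Matrix.vecMulVec w w = (w ⬝ᵥ w) • Matrix.vecMulVec w w := by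
    rw [Matrix.vecMulVec_mul_vecMulVec, Matrix.vecMulVec_smul]
  have hmv : ∀ z, Matrix.vecMulVec w w *ᵥ z = (w ⬝ᵥ z) • w := fun z => by
    ext i
    simp only [Matrix.mulVec, Matrix.vecMulVec_apply, dotProduct, Pi.smul_apply, smul_eq_mul,
      Finset.sum_mul]
    exact Finset.sum_congr rfl fun j _ => by ring
  refine ⟨1 - (2 / (w ⬝ᵥ w)) • Matrix.vecMulVec w w, ?_, ?_⟩
  · rw [ht]
    simp only [sub_mul, mul_sub, Matrix.smul_mul, Matrix.mul_smul, one_mul, mul_one, hv]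
    rw [smul_smul _ (w ⬝ᵥ w), div_mul_cancel₀ _ hw]
    module
  · rw [ht, Matrix.sub_mulVec, Matrix.one_mulVec, Matrix.smul_mulVec, hmv, smul_smul]
    have : 2 / (w ⬝ᵥ w) * (w ⬝ᵥ lastVec d) = -1 := by
      rw [div_mul_eq_mul_div, div_eq_iff hw]
      linarith
    rw [this, ← hwd]
    simp

/-- If the orthogonal matrix has determinant `-1`, multiplying on the left by `diag(-1, 1, …, 1)`
corrects it. This keeps `γ` because the flipped coordinate is not the last one. -/
theorem exists_poisson_eq (hd : 2 ≤ d) (b : ℝ) {γ : Fin (d + 1) → ℝ} (hγ : γ ⬝ᵥ γ = 1) :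
    ∃ q ∈ configSpace d b, poisson d q = γ := by
  suffices h : ∃ R ∈ Matrix.specialOrthogonalGroup (Fin (d + 1)) ℝ, Rᵀ *ᵥ lastVec d = γ by
    obtain ⟨R, hR, h⟩ := h
    exact ⟨(R, b • lastVec d), ⟨hR, by simp [lastVec_last]⟩, h⟩
  obtain ⟨H, hH, he⟩ := exists_orthogonal_transpose_mulVec_eq hγ
  rcases mul_self_eq_one_iff.mp (det_sq_eq_one hH) with h1 | h1
  · exact ⟨H, mem_specialOrthogonalGroup_iff_transpose.mpr ⟨hH, h1⟩, he⟩
  let s : Fin (d + 1) → ℝ := fun i => if i = 0 then -1 else 1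
  have hss : ∀ i, s i * s i = 1 := fun i => by
    simp only [s]
    split_ifs <;> norm_num
  have h0 : Fin.last d ≠ 0 := by
    rw [Ne, Fin.ext_iff, Fin.val_last, Fin.val_zero]
    omega
  refine ⟨Matrix.diagonal s * H, mem_specialOrthogonalGroup_iff_transpose.mpr ⟨?_, ?_⟩, ?_⟩
  · have hD : Matrix.diagonal s * Matrix.diagonal s = 1 := by
      rw [Matrix.diagonal_mul_diagonal, ← Matrix.diagonal_one]
      exact congrArg _ (funext hss)
    rw [Matrix.transpose_mul, Matrix.diagonal_transpose, mul_assoc, ← mul_assoc (Matrix.diagonal s),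
      hD, one_mul, hH]
  · rw [Matrix.det_mul, h1, Matrix.det_diagonal, Finset.prod_ite_eq']
    simp
  · rw [Matrix.transpose_mul, Matrix.diagonal_transpose, ← Matrix.mulVec_mulVec]
    have : Matrix.diagonal s *ᵥ lastVec d = lastVec d := by
      ext i
      rw [Matrix.mulVec_diagonal]
      by_cases hi : i = Fin.last d
      · simp [s, hi, h0]
      · simp [lastVec, hi]
    rw [this, he]

theorem hasDirDerivWithin_poisson (s : Set (Ambient d)) (q v : Ambient d) :
    HasDirDerivWithin (poisson d) s q v (v.1ᵀ *ᵥ lastVec d) := by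
  have hid : HasDirDerivWithin (fun y : Ambient d => y) s q v v := .id
  have h := (hid.linear (LinearMap.fst ℝ _ _)).transpose.mulVec (.const (lastVec d))
  exact h.congr_deriv (by simp)

/-- Here `γ̇ = Ṙᵀ e_n = -Rᵀ (u ∧ e_n) e_n`. So on the distribution the tangent map of the projection
is `u ↦ -Rᵀ u`, with inverse `v ↦ -R v`, the formula for horizontal lifts. -/
theorem hasDirDerivWithin_poisson_rollVec (s : Set (Ambient d)) (q : Ambient d)
    {u : Fin (d + 1) → ℝ} (hu : u (Fin.last d) = 0) :
    HasDirDerivWithin (poisson d) s q (rollVec b u q) (-(q.1ᵀ *ᵥ u)) := by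
  refine (hasDirDerivWithin_poisson s q _).congr_deriv ?_
  rw [rollVec, Matrix.transpose_mul, wedge_transpose, ← Matrix.mulVec_mulVec, Matrix.neg_mulVec,
    wedge_lastVec_mulVec hu, Matrix.mulVec_neg]

theorem mapsTo_poisson : Set.MapsTo (poisson d) (configSpace d b) (unitSphere d) :=
  fun _ hq => poisson_dotProduct_self hq

theorem neg_mulVec_last {q : Ambient d} {v : Fin (d + 1) → ℝ} (hv : poisson d q ⬝ᵥ v = 0) :
    (-(q.1 *ᵥ v)) (Fin.last d) = 0 := by
  rw [Pi.neg_apply, mulVec_last_eq, hv, neg_zero]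

theorem hasDirDerivWithin_poisson_rollVec_neg (s : Set (Ambient d)) {q : Ambient d}
    (hq : q ∈ configSpace d b) {v : Fin (d + 1) → ℝ} (hv : poisson d q ⬝ᵥ v = 0) :
    HasDirDerivWithin (poisson d) s q (rollVec b (-(q.1 *ᵥ v)) q) v := by
  refine (hasDirDerivWithin_poisson_rollVec s q (neg_mulVec_last hv)).congr_deriv ?_
  rw [Matrix.mulVec_neg, neg_neg, Matrix.mulVec_mulVec, transpose_mul_self_of_mem hq.1,
    Matrix.one_mulVec]

theorem dotProduct_eq_zero_of_mem_tangentSpaceAt {γ v : Fin (d + 1) → ℝ}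
    (hγ : γ ∈ unitSphere d) (hv : v ∈ tangentSpaceAt (unitSphere d) γ) : γ ⬝ᵥ v = 0 := by
  have hid : HasDirDerivWithin (fun y : Fin (d + 1) → ℝ => y) (unitSphere d) γ v v := .id
  have h := (hid.dotProduct hid).of_const (c := 1) (fun y hy => hy) hγ hv
  rw [dotProduct_comm v] at h
  linarith

/-- No curve on the sphere is needed: a vector orthogonal to `γ` is the image of a rolling velocity.
-/
theorem mem_tangentSpaceAt_unitSphere {q : Ambient d} (hq : q ∈ configSpace d b)
    {v : Fin (d + 1) → ℝ} :
    v ∈ tangentSpaceAt (unitSphere d) (poisson d q) ↔ poisson d q ⬝ᵥ v = 0 := by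
  refine ⟨dotProduct_eq_zero_of_mem_tangentSpaceAt (mapsTo_poisson hq), fun hv => ?_⟩
  have h1 := (rollVec_mem_distribution hq (neg_mulVec_last hv)).1
  exact (hasDirDerivWithin_poisson_rollVec_neg _ hq hv).mem_tangentSpaceAt mapsTo_poisson h1

theorem isOrbitSpace_unitSphere (hd : 2 ≤ d) (b : ℝ) :
    IsOrbitSpace (configSpace d b) (specialEuclidean d) (seAction d) (unitSphere d)
      (poisson d) where
  submanifold := isEmbeddedSubmanifold_unitSphere d
  smooth := contDiffOn_poisson _
  image_eq := by
    refine Set.Subset.antisymm (Set.image_subset_iff.mpr mapsTo_poisson) fun γ hγ => ?_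
    exact exists_poisson_eq hd b hγ
  submersion q hq := by
    ext v
    rw [Submodule.mem_map]
    constructor
    · rintro ⟨w, hw, rfl⟩
      have h := (hasDirDerivWithin_poisson (configSpace d b) q w)
      exact (h.fderivWithin_apply hw).symm ▸ h.mem_tangentSpaceAt mapsTo_poisson hw
    · intro hv
      rw [mem_tangentSpaceAt_unitSphere hq] at hv
      have h1 := (rollVec_mem_distribution hq (neg_mulVec_last hv)).1
      exact ⟨_, h1, (hasDirDerivWithin_poisson_rollVec_neg _ hq hv).fderivWithin_apply h1⟩
  fibres q hq p hp := by
    constructor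
    · intro h
      -- The candidate rotation sends `e_n` to the common Poisson vector and then back to `e_n`.
      have hhr : IsHorizontalRotation (p.1 * q.1ᵀ) := by
        refine ⟨mul_mem hp.1 (transpose_mem hq.1), ?_⟩
        rw [← Matrix.mulVec_mulVec]
        exact (congrArg (p.1 *ᵥ ·) h.symm).trans (mulVec_poisson hp)
      refine ⟨_, mem_matrixSet_specialEuclidean.mpr
        ⟨_, p.2 - (p.1 * q.1ᵀ) *ᵥ q.2, hhr, ?_, rfl⟩, ?_⟩
      · rw [Pi.sub_apply, mulVec_last hhr.1 hhr.2, hp.2, hq.2, sub_self]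
      · rw [seAction_seMatrix, mul_assoc, transpose_mul_self_of_mem hq.1, mul_one,
          add_sub_cancel]
    · rintro ⟨g, hg, rfl⟩
      obtain ⟨h, y, hh, hy, rfl⟩ := mem_matrixSet_specialEuclidean.mp hg
      exact poisson_seAction hh y q

end ShapeSpace

end RouthSphere

/-- The projection is defined by choice. Two candidates differ by a vector of `D_q` orthogonal to
`D_q`, hence to itself, and positivity makes it zero. -/
theorem IsNonholonomicSystem.metricProjection_eq {E : Type*} [NormedAddCommGroup E]
    [NormedSpace ℝ E] {N : NonholonomicData E} {r : ℕ} (hN : IsNonholonomicSystem N r) {q v u : E}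
    (hq : q ∈ N.Q) (hu : u ∈ N.D q) (h : ∀ w ∈ N.D q, N.metric q (v - u) w = 0) :
    metricProjection N q v = u := by
  obtain ⟨h1, h2⟩ := Classical.epsilon_spec
    (p := fun u => u ∈ N.D q ∧ ∀ w ∈ N.D q, N.metric q (v - u) w = 0) ⟨u, hu, h⟩
  change metricProjection N q v ∈ N.D q at h1
  change ∀ w ∈ N.D q, N.metric q (v - metricProjection N q v) w = 0 at h2
  have h3 := (N.D q).sub_mem h1 hu
  by_contra hne
  have h4 := hN.metric_pos q hq _ (hN.le_tangent q hq h3) (sub_ne_zero.mpr hne)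
  have h5 : metricProjection N q v - u = (v - u) - (v - metricProjection N q v) := by abel
  have h6 : N.metric q (metricProjection N q v - u) (metricProjection N q v - u) = 0 := by
    have h7 := h _ h3
    have h8 := h2 _ h3
    generalize metricProjection N q v - u = w at *
    have h9 : N.metric q w = N.metric q (v - u) - N.metric q (v - metricProjection N q v) := by
      rw [← map_sub, ← h5]
    rw [h9, LinearMap.sub_apply, h7, h8, sub_zero]
  exact h4.ne' h6

/-- Needed because horizontal lift fields, being defined by choice, are known only on the
configuration space. -/
theorem lieBracketWithin_congr_of_eqOn {E : Type*} [NormedAddCommGroup E] [NormedSpace ℝ E]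
    {X X' Y Y' : E → E} {s : Set E} {x : E} (hX : ∀ y ∈ s, X y = X' y) (hY : ∀ y ∈ s, Y y = Y' y)
    (hx : x ∈ s) :
    VectorField.lieBracketWithin ℝ X Y s x = VectorField.lieBracketWithin ℝ X' Y' s x := by
  rw [VectorField.lieBracketWithin_eq, VectorField.lieBracketWithin_eq]
  simp only [fderivWithin_congr hX (hX x hx), fderivWithin_congr hY (hY x hx), hX x hx, hY x hx]

/-! ### Horizontal lifts, metric projection and the gyroscopic tensor. -/

namespace RouthSphere

variable {d : ℕ} {m b ℓ grav J₁ Jₙ : ℝ}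

theorem horizontalLift_system {q : Ambient d} (hq : q ∈ configSpace d b) {v : Fin (d + 1) → ℝ}
    (hv : poisson d q ⬝ᵥ v = 0) :
    horizontalLift (system d m b ℓ grav J₁ Jₙ) (poisson d) q v = rollVec b (-(q.1 *ᵥ v)) q := by
  obtain ⟨h1, h2⟩ := Classical.epsilon_spec
    (p := fun w => w ∈ (system d m b ℓ grav J₁ Jₙ).D q ∧
      fderivWithin ℝ (poisson d) (system d m b ℓ grav J₁ Jₙ).Q q w = v)
    ⟨_, rollVec_mem_distribution hq (neg_mulVec_last hv),
      (hasDirDerivWithin_poisson_rollVec_neg _ hq hv).fderivWithin_apply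
        (rollVec_mem_distribution hq (neg_mulVec_last hv)).1⟩
  obtain ⟨u, hu, he⟩ := (mem_distribution_iff hq).mp h1
  refine he.trans (congrArg (rollVec b · q) ?_)
  rw [he] at h2
  have h3 := ((hasDirDerivWithin_poisson_rollVec (configSpace d b) q hu).fderivWithin_apply
    (rollVec_mem_distribution hq hu).1).symm.trans h2
  rw [← h3, Matrix.mulVec_neg, neg_neg, Matrix.mulVec_mulVec, mul_transpose_self_of_mem hq.1,
    Matrix.one_mulVec]

theorem massTensor_eq : massTensor d J₁ Jₙ =
    J₁ • 1 + (Jₙ - J₁) • Matrix.vecMulVec (lastVec d) (lastVec d) := by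
  ext i j
  simp only [massTensor, Matrix.diagonal_apply, Matrix.add_apply, Matrix.smul_apply,
    Matrix.one_apply, Matrix.vecMulVec_apply, lastVec, Pi.single_apply, smul_eq_mul]
  split_ifs <;> simp_all

/-- Since `𝕁` is `J₁` times the identity plus `(Jₙ - J₁) E_n E_nᵗ`, the inertia form is a multiple
of the Killing form plus a term seeing only `A E_n` and `B E_n`. -/
theorem killing_inertia_of_skew {A B : Matrix (Fin (d + 1)) (Fin (d + 1)) ℝ} (hA : Aᵀ = -A)
    (hB : Bᵀ = -B) : killing (inertia d J₁ Jₙ A) B =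
      2 * J₁ * killing A B + (Jₙ - J₁) * (A *ᵥ lastVec d ⬝ᵥ B *ᵥ lastVec d) := by
  have key : ∀ C D : Matrix (Fin (d + 1)) (Fin (d + 1)) ℝ, Cᵀ = -C →
      (Matrix.vecMulVec (lastVec d) (lastVec d) * C * D).trace =
        -(C *ᵥ lastVec d ⬝ᵥ D *ᵥ lastVec d) := by
    intro C D hC
    rw [mul_assoc, trace_vecMulVec_mul, ← Matrix.mulVec_mulVec, Matrix.dotProduct_mulVec,
      ← Matrix.mulVec_transpose, hC, Matrix.neg_mulVec, neg_dotProduct]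
  have h2 : (A * Matrix.vecMulVec (lastVec d) (lastVec d) * B).trace =
      -(A *ᵥ lastVec d ⬝ᵥ B *ᵥ lastVec d) := by
    rw [Matrix.trace_mul_cycle, Matrix.trace_mul_cycle, key B A hB, dotProduct_comm]
  rw [killing, killing, inertia, massTensor_eq]
  simp only [Matrix.add_mul, Matrix.mul_add, Matrix.smul_mul, Matrix.mul_smul, one_mul, mul_one,
    Matrix.trace_add, Matrix.trace_smul, key A B hA, h2, smul_eq_mul]
  ring

theorem killing_wedge (a c u w : Fin (d + 1) → ℝ) :
    killing (wedge a c) (wedge u w) = (a ⬝ᵥ u) * (c ⬝ᵥ w) - (a ⬝ᵥ w) * (c ⬝ᵥ u) := by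
  rw [killing, trace_wedge_mul_wedge]
  ring

theorem wedge_mulVec_lastVec (u w : Fin (d + 1) → ℝ) :
    wedge u w *ᵥ lastVec d = w (Fin.last d) • u - u (Fin.last d) • w := by
  rw [wedge_mulVec, dotProduct_comm w, dotProduct_comm u, lastVec_dotProduct, lastVec_dotProduct]

theorem massCentreVel_rollVec (q : Ambient d) (u : Fin (d + 1) → ℝ) :
    massCentreVel d ℓ q (rollVec b u q) =
      (b + ℓ * poisson d q (Fin.last d)) • (q.1ᵀ *ᵥ u) -
        (ℓ * (q.1ᵀ *ᵥ u) (Fin.last d)) • poisson d q := by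
  rw [massCentreVel, bodyVel_rollVec, wedge_mulVec_lastVec, rollVec, Matrix.mulVec_smul]
  module

theorem poisson_dotProduct_transpose_mulVec {q : Ambient d} (hq : q ∈ configSpace d b)
    {u : Fin (d + 1) → ℝ} (hu : u (Fin.last d) = 0) : poisson d q ⬝ᵥ q.1ᵀ *ᵥ u = 0 := by
  rw [poisson, ← mulVec_dotProduct_mulVec hq, Matrix.mulVec_mulVec, Matrix.mulVec_mulVec,
    mul_transpose_self_of_mem hq.1, Matrix.one_mulVec, Matrix.one_mulVec, lastVec_dotProduct, hu]

/-- The expression `2 J₁ + (Jₙ - J₁) t² + m (b + ℓ t)²`, so that `φ = - ln(reducedMass γ_n) / 2`. -/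
def reducedMass (m b ℓ J₁ Jₙ t : ℝ) : ℝ := 2 * J₁ + (Jₙ - J₁) * t ^ 2 + m * (b + ℓ * t) ^ 2

/-- For `t² ≤ 1` one has `2 J₁ - J₁ t² ≥ J₁ > 0`, and the other terms are nonnegative. -/
theorem reducedMass_pos (hm : 0 < m) (hJ₁ : 0 < J₁) (hJₙ : 0 < Jₙ) {t : ℝ} (ht : t ^ 2 ≤ 1) :
    0 < reducedMass m b ℓ J₁ Jₙ t := by
  have h1 : 0 ≤ m * (b + ℓ * t) ^ 2 := mul_nonneg hm.le (sq_nonneg _)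
  have h2 : 0 ≤ Jₙ * t ^ 2 := mul_nonneg hJₙ.le (sq_nonneg _)
  have h3 : J₁ * t ^ 2 ≤ J₁ * 1 := mul_le_mul_of_nonneg_left ht hJ₁.le
  rw [reducedMass]
  linarith

/-- The vectors `Rᵀ s` and `Rᵀ t` are orthogonal to `γ`, which removes the mixed terms. The metric
is then conformal to the Euclidean one except for a product of last components. -/
theorem kineticMetric_rollVec_rollVec {q : Ambient d} (hq : q ∈ configSpace d b)
    {s t : Fin (d + 1) → ℝ} (hs : s (Fin.last d) = 0) (ht : t (Fin.last d) = 0) :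
    kineticMetric d m ℓ J₁ Jₙ q (rollVec b t q) (rollVec b s q) =
      reducedMass m b ℓ J₁ Jₙ (poisson d q (Fin.last d)) * (q.1ᵀ *ᵥ t ⬝ᵥ q.1ᵀ *ᵥ s) +
        (Jₙ - J₁ + m * ℓ ^ 2) *
          ((q.1ᵀ *ᵥ t) (Fin.last d) * (q.1ᵀ *ᵥ s) (Fin.last d)) := by
  have hγ := poisson_dotProduct_self hq
  have hs' := poisson_dotProduct_transpose_mulVec hq hs
  have ht' := poisson_dotProduct_transpose_mulVec hq ht
  rw [kineticMetric_apply, massCentreVel_rollVec, massCentreVel_rollVec, bodyVel_rollVec,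
    bodyVel_rollVec, killing_inertia_of_skew (wedge_transpose _ _) (wedge_transpose _ _),
    killing_wedge, wedge_mulVec_lastVec, wedge_mulVec_lastVec, reducedMass]
  generalize q.1ᵀ *ᵥ s = a at *
  generalize q.1ᵀ *ᵥ t = z at *
  generalize poisson d q = γ at *
  have hz : z ⬝ᵥ γ = 0 := (dotProduct_comm _ _).trans ht'
  simp only [sub_dotProduct, dotProduct_sub, smul_dotProduct, dotProduct_smul, smul_eq_mul, hγ,
    hs', hz]
  ring

/-- The Killing product of `y ∧ z` with `Rᵀ s ∧ γ` vanishes because `y` and `z` are orthogonal to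
`γ`. Only the axial inertia and the offset `ℓ` couple spin to rolling. -/
theorem kineticMetric_spin_rollVec {q : Ambient d} (hq : q ∈ configSpace d b)
    {s y z : Fin (d + 1) → ℝ} (hs : s (Fin.last d) = 0) (hy : poisson d q ⬝ᵥ y = 0)
    (hz : poisson d q ⬝ᵥ z = 0) :
    kineticMetric d m ℓ J₁ Jₙ q (wedge (q.1 *ᵥ y) (q.1 *ᵥ z) * q.1, 0) (rollVec b s q) =
      ((Jₙ - J₁) * poisson d q (Fin.last d) + m * ℓ * (b + ℓ * poisson d q (Fin.last d))) *
        ((z (Fin.last d) • y - y (Fin.last d) • z) ⬝ᵥ q.1ᵀ *ᵥ s) := by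
  have hs' := poisson_dotProduct_transpose_mulVec hq hs
  have hb : bodyVel d q (wedge (q.1 *ᵥ y) (q.1 *ᵥ z) * q.1, 0) = wedge y z := by
    rw [bodyVel, ← mul_wedge_mul_transpose, mul_assoc _ q.1ᵀ, transpose_mul_self_of_mem hq.1,
      mul_one, ← mul_assoc, transpose_mul_self_of_mem hq.1, one_mul]
  rw [kineticMetric_apply, massCentreVel_rollVec, massCentreVel, bodyVel_rollVec, hb,
    killing_inertia_of_skew (wedge_transpose _ _) (wedge_transpose _ _),
    killing_wedge, wedge_mulVec_lastVec, wedge_mulVec_lastVec, Matrix.mulVec_zero, zero_add]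
  generalize q.1ᵀ *ᵥ s = a at *
  generalize poisson d q = γ at *
  rw [dotProduct_comm] at hy hz
  simp only [sub_dotProduct, dotProduct_sub, smul_dotProduct, dotProduct_smul, smul_eq_mul, hy, hz]
  ring

theorem sq_last_le_one {γ : Fin (d + 1) → ℝ} (hγ : γ ⬝ᵥ γ = 1) : γ (Fin.last d) ^ 2 ≤ 1 := by
  rw [← hγ, sq]
  exact Finset.single_le_sum (f := fun i => γ i * γ i) (fun i _ => mul_self_nonneg _)
    (Finset.mem_univ _)

/-- The metric projection of the sum of a rolling velocity and a spin. -/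
theorem metricProjection_rollVec_add_spin (hd : 2 ≤ d) (hm : 0 < m) (hJ₁ : 0 < J₁) (hJₙ : 0 < Jₙ)
    {q : Ambient d} (hq : q ∈ configSpace d b) {v y z : Fin (d + 1) → ℝ}
    (hv : poisson d q ⬝ᵥ v = 0) (hy : poisson d q ⬝ᵥ y = 0) (hz : poisson d q ⬝ᵥ z = 0) :
    metricProjection (system d m b ℓ grav J₁ Jₙ) q
        (rollVec b (-(q.1 *ᵥ v)) q + (wedge (q.1 *ᵥ y) (q.1 *ᵥ z) * q.1, 0)) =
      rollVec b (-(q.1 *ᵥ (v - (((Jₙ - J₁) * poisson d q (Fin.last d) +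
        m * ℓ * (b + ℓ * poisson d q (Fin.last d))) /
        reducedMass m b ℓ J₁ Jₙ (poisson d q (Fin.last d))) •
          (z (Fin.last d) • y - y (Fin.last d) • z)))) q := by
  have hP := reducedMass_pos (b := b) (ℓ := ℓ) hm hJ₁ hJₙ
    (sq_last_le_one (poisson_dotProduct_self hq))
  have hspin := fun s hs =>
    kineticMetric_spin_rollVec (m := m) (ℓ := ℓ) (J₁ := J₁) (Jₙ := Jₙ) (s := s) hq hs hy hz
  have hp : poisson d q ⬝ᵥ (z (Fin.last d) • y - y (Fin.last d) • z) = 0 := by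
    rw [dotProduct_sub, dotProduct_smul, dotProduct_smul, hy, hz, smul_zero, smul_zero, sub_zero]
  -- This vanishing removes the non-conformal term of the metric, so that the projection of the spin
  -- is a scalar multiple of `rollVec b (R p) q`.
  have hpn : (z (Fin.last d) • y - y (Fin.last d) • z) (Fin.last d) = 0 := by
    simp only [Pi.sub_apply, Pi.smul_apply, smul_eq_mul]
    ring
  generalize z (Fin.last d) • y - y (Fin.last d) • z = p at *
  generalize (Jₙ - J₁) * poisson d q (Fin.last d) +
    m * ℓ * (b + ℓ * poisson d q (Fin.last d)) = c at *
  generalize hk : c / reducedMass m b ℓ J₁ Jₙ (poisson d q (Fin.last d)) = k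
  have hkp : poisson d q ⬝ᵥ (k • p) = 0 := by rw [dotProduct_smul, hp, smul_zero]
  have hvk : poisson d q ⬝ᵥ (v - k • p) = 0 := by rw [dotProduct_sub, hv, hkp, sub_zero]
  refine (isNonholonomicSystem_system hd hm hJ₁ hJₙ).metricProjection_eq hq
    (rollVec_mem_distribution hq (neg_mulVec_last hvk)) fun w hw => ?_
  obtain ⟨s, hs, rfl⟩ := (mem_distribution_iff hq).mp hw
  have h1 : rollVec b (-(q.1 *ᵥ v)) q + (wedge (q.1 *ᵥ y) (q.1 *ᵥ z) * q.1, 0) -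
      rollVec b (-(q.1 *ᵥ (v - k • p))) q =
        (wedge (q.1 *ᵥ y) (q.1 *ᵥ z) * q.1, 0) - rollVec b (q.1 *ᵥ (k • p)) q := by
    rw [Matrix.mulVec_sub, neg_sub, sub_eq_neg_add (q.1 *ᵥ k • p), rollVec_add]
    abel
  change kineticMetric d m ℓ J₁ Jₙ q _ _ = 0
  have hkn : (q.1 *ᵥ (k • p)) (Fin.last d) = 0 := by rw [mulVec_last_eq, hkp]
  rw [h1, map_sub, LinearMap.sub_apply, hspin s hs, kineticMetric_rollVec_rollVec hq hs hkn,
    Matrix.mulVec_mulVec, transpose_mul_self_of_mem hq.1, Matrix.one_mulVec, Pi.smul_apply, hpn,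
    smul_zero, zero_mul, mul_zero, add_zero, smul_dotProduct, smul_eq_mul, ← mul_assoc, ← hk,
    mul_div_cancel₀ _ hP.ne', sub_self]

/-- The derivative of `reducedMass` is twice the coefficient coupling spin to rolling; the factor
`-1/2` in `φ` cancels the two. -/
theorem hasDirDerivWithin_phi (hm : 0 < m) (hJ₁ : 0 < J₁) (hJₙ : 0 < Jₙ) {γ : Fin (d + 1) → ℝ}
    (hγ : γ ⬝ᵥ γ = 1) (s : Set (Fin (d + 1) → ℝ)) (v : Fin (d + 1) → ℝ) :
    HasDirDerivWithin (phi d m b ℓ J₁ Jₙ) s γ v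
      (-(((Jₙ - J₁) * γ (Fin.last d) + m * ℓ * (b + ℓ * γ (Fin.last d))) /
        reducedMass m b ℓ J₁ Jₙ (γ (Fin.last d))) * v (Fin.last d)) := by
  have hP := reducedMass_pos (b := b) (ℓ := ℓ) hm hJ₁ hJₙ (sq_last_le_one hγ)
  have hid : HasDirDerivWithin (fun y : Fin (d + 1) → ℝ => y) s γ v v := .id
  generalize ht : γ (Fin.last d) = t at hP
  have h1 : HasDerivAt (reducedMass m b ℓ J₁ Jₙ)
      (2 * ((Jₙ - J₁) * t + m * ℓ * (b + ℓ * t))) t := by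
    have h2 := ((((hasDerivAt_id t).pow 2).const_mul (Jₙ - J₁)).const_add (2 * J₁)).add
      (((((hasDerivAt_id t).const_mul ℓ).const_add b).pow 2).const_mul m)
    convert! h2 using 1
    simp
    ring
  have h3 := ((h1.log hP.ne').const_mul (-(1 / 2))).hasFDerivAt.hasFDerivWithinAt (s := Set.univ)
  rw [← ht] at h3
  refine HasDirDerivWithin.comp (f := fun γ : Fin (d + 1) → ℝ => γ (Fin.last d))
    (g := fun t => -(1 / 2) * Real.log (reducedMass m b ℓ J₁ Jₙ t)) ⟨_, h3, ?_⟩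
    (hid.apply (Fin.last d)) (Set.mapsTo_univ _ _)
  simp only [ContinuousLinearMap.toSpanSingleton_apply, smul_eq_mul, ht]
  field_simp

theorem contDiffOn_phi (hm : 0 < m) (hJ₁ : 0 < J₁) (hJₙ : 0 < Jₙ) :
    ContDiffOn ℝ ∞ (phi d m b ℓ J₁ Jₙ) (unitSphere d) := by
  have hn : ContDiffOn ℝ ∞ (fun γ : Fin (d + 1) → ℝ => γ (Fin.last d)) (unitSphere d) :=
    contDiffOn_id.apply (Fin.last d)
  refine contDiffOn_const.mul (ContDiffOn.log ?_ fun γ hγ =>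
    (reducedMass_pos hm hJ₁ hJₙ (sq_last_le_one hγ)).ne')
  exact (contDiffOn_const.add (contDiffOn_const.mul (hn.pow 2))).add
    (contDiffOn_const.mul ((contDiffOn_const.add (contDiffOn_const.mul hn)).pow 2))

theorem gyroscopicTensor_system (hd : 2 ≤ d) (hm : 0 < m) (hJ₁ : 0 < J₁) (hJₙ : 0 < Jₙ)
    {Y Z : (Fin (d + 1) → ℝ) → Fin (d + 1) → ℝ} (hY : IsSmoothVectorField (unitSphere d) Y)
    (hZ : IsSmoothVectorField (unitSphere d) Z) {q : Ambient d} (hq : q ∈ configSpace d b) :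
    gyroscopicTensor (system d m b ℓ grav J₁ Jₙ) (unitSphere d) (poisson d) Y Z q =
      -(((Jₙ - J₁) * poisson d q (Fin.last d) + m * ℓ * (b + ℓ * poisson d q (Fin.last d))) /
        reducedMass m b ℓ J₁ Jₙ (poisson d q (Fin.last d))) •
        (Z (poisson d q) (Fin.last d) • Y (poisson d q) -
          Y (poisson d q) (Fin.last d) • Z (poisson d q)) := by
  have hγ := mapsTo_poisson hq
  have hP := reducedMass_pos (b := b) (ℓ := ℓ) hm hJ₁ hJₙ (sq_last_le_one hγ)
  have orth : ∀ {X : (Fin (d + 1) → ℝ) → Fin (d + 1) → ℝ}, IsSmoothVectorField (unitSphere d) X →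
      ∀ γ ∈ unitSphere d, γ ⬝ᵥ X γ = 0 := fun hX γ hγ =>
    dotProduct_eq_zero_of_mem_tangentSpaceAt hγ (hX.tangent γ hγ)
  -- the derivatives of the fields on the sphere
  have hder : ∀ {X : (Fin (d + 1) → ℝ) → Fin (d + 1) → ℝ}, IsSmoothVectorField (unitSphere d) X →
      ∀ v, HasDirDerivWithin X (unitSphere d) (poisson d q) v
        (fderivWithin ℝ X (unitSphere d) (poisson d q) v) := fun hX v =>
    .of_differentiable ((hX.smooth.differentiableOn (by simp)) _ hγ)
  -- Obtained by differentiating `γ · X(γ) = 0` along `v`.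
  have hdot : ∀ {X : (Fin (d + 1) → ℝ) → Fin (d + 1) → ℝ}, IsSmoothVectorField (unitSphere d) X →
      ∀ v ∈ tangentSpaceAt (unitSphere d) (poisson d q),
        poisson d q ⬝ᵥ fderivWithin ℝ X (unitSphere d) (poisson d q) v =
          -(v ⬝ᵥ X (poisson d q)) := fun hX v hv =>
    eq_neg_of_add_eq_zero_left
      ((HasDirDerivWithin.id.dotProduct (hder hX v)).of_const (c := 0) (orth hX) hγ hv)
  have hYq := orth hY _ hγ
  have hZq := orth hZ _ hγ
  have hu := neg_mulVec_last hYq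
  have hw := neg_mulVec_last hZq
  -- the derivatives of the horizontal lifts
  have hlift : ∀ {X : (Fin (d + 1) → ℝ) → Fin (d + 1) → ℝ}, IsSmoothVectorField (unitSphere d) X →
      ∀ v : Fin (d + 1) → ℝ, poisson d q ⬝ᵥ v = 0 →
        HasDirDerivWithin (fun p : Ambient d => -(p.1 *ᵥ X (poisson d p))) (configSpace d b) q
          (rollVec b (-(q.1 *ᵥ v)) q)
          (-(q.1 *ᵥ fderivWithin ℝ X (unitSphere d) (poisson d q) v) -
            (v ⬝ᵥ X (poisson d q)) • lastVec d) := by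
    intro X hX v hv
    have hid : HasDirDerivWithin (fun y : Ambient d => y) (configSpace d b) q
      (rollVec b (-(q.1 *ᵥ v)) q) _ := .id
    have h1 := ((hid.linear (LinearMap.fst ℝ _ _)).mulVec ((hder hX v).comp
      (hasDirDerivWithin_poisson_rollVec_neg (configSpace d b) hq hv) mapsTo_poisson)).const_smul
      (-1)
    have h2 : (rollVec b (-(q.1 *ᵥ v)) q).1 *ᵥ X (poisson d q) =
        (v ⬝ᵥ X (poisson d q)) • lastVec d := by
      rw [rollVec, ← Matrix.mulVec_mulVec, wedge_mulVec, lastVec_dotProduct, mulVec_last_eq,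
        orth hX _ hγ, neg_dotProduct, mulVec_dotProduct_mulVec hq]
      simp
    simp only [LinearMap.fst_apply, h2, neg_one_smul] at h1
    exact h1.congr_deriv (by abel)
  have hB := lieBracketWithin_rollVec hq (u := fun p => -(p.1 *ᵥ Y (poisson d p)))
    (w := fun p => -(p.1 *ᵥ Z (poisson d p))) hu hw (hlift hY _ hZq) (hlift hZ _ hYq)
  have hfield : ∀ {X : (Fin (d + 1) → ℝ) → Fin (d + 1) → ℝ},
      IsSmoothVectorField (unitSphere d) X → ∀ p ∈ configSpace d b,
        horizontalLiftField (system d m b ℓ grav J₁ Jₙ) (poisson d) X p =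
          rollVec b (-(p.1 *ᵥ X (poisson d p))) p := fun hX p hp =>
    horizontalLift_system hp (orth hX _ (mapsTo_poisson hp))
  -- The bracket is tangent to the sphere: the normal parts of both derivatives are `-(Y · Z)` and
  -- cancel.
  have hS : poisson d q ⬝ᵥ
      VectorField.lieBracketWithin ℝ Y Z (unitSphere d) (poisson d q) = 0 := by
    rw [VectorField.lieBracketWithin_eq]
    exact (dotProduct_sub _ _ _).trans (by
      rw [hdot hZ _ (hY.tangent _ hγ), hdot hY _ (hZ.tangent _ hγ),
        dotProduct_comm (Z (poisson d q)), sub_self])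
  have hQ : VectorField.lieBracketWithin ℝ
      (horizontalLiftField (system d m b ℓ grav J₁ Jₙ) (poisson d) Y)
      (horizontalLiftField (system d m b ℓ grav J₁ Jₙ) (poisson d) Z) (configSpace d b) q =
        rollVec b (-(q.1 *ᵥ VectorField.lieBracketWithin ℝ Y Z (unitSphere d) (poisson d q))) q +
          (wedge (q.1 *ᵥ Y (poisson d q)) (q.1 *ᵥ Z (poisson d q)) * q.1, 0) := by
    refine (lieBracketWithin_congr_of_eqOn (hfield hY) (hfield hZ) hq).trans (hB.trans ?_)
    -- The multiples of `e_n` in the derivatives of the two lifts are both `-(Y · Z)`, so they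
    -- cancel and the rolling part is the lift of `[Y, Z]`. In the spin part the two minus signs
    -- cancel.
    congr 2
    · rw [VectorField.lieBracketWithin_eq, dotProduct_comm (Z (poisson d q))]
      simp only [Matrix.mulVec_sub]
      abel
    · congr 1
      ext i j
      simp only [wedge_apply, Pi.neg_apply]
      ring
  have hT := metricProjection_rollVec_add_spin (m := m) (ℓ := ℓ) (grav := grav) hd hm hJ₁ hJₙ hq
    hS hYq hZq
  rw [← hQ] at hT
  generalize hk : ((Jₙ - J₁) * poisson d q (Fin.last d) +
    m * ℓ * (b + ℓ * poisson d q (Fin.last d))) /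
      reducedMass m b ℓ J₁ Jₙ (poisson d q (Fin.last d)) = k at *
  have hv : poisson d q ⬝ᵥ (VectorField.lieBracketWithin ℝ Y Z (unitSphere d) (poisson d q) -
      k • (Z (poisson d q) (Fin.last d) • Y (poisson d q) -
        Y (poisson d q) (Fin.last d) • Z (poisson d q))) = 0 := by
    simp only [dotProduct_sub, dotProduct_smul, hS, hYq, hZq, smul_zero, sub_zero]
  have hfinal := (hasDirDerivWithin_poisson_rollVec_neg (configSpace d b) hq hv).fderivWithin_apply
    (rollVec_mem_distribution hq (neg_mulVec_last hv)).1
  rw [← hT] at hfinal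
  refine (congrArg (· - VectorField.lieBracketWithin ℝ Y Z (unitSphere d) (poisson d q))
    hfinal).trans ?_
  module

theorem isPhiSimpleChaplygin_system (hd : 2 ≤ d) (hm : 0 < m) (hJ₁ : 0 < J₁) (hJₙ : 0 < Jₙ) :
    IsPhiSimpleChaplygin (system d m b ℓ grav J₁ Jₙ) d (specialEuclidean d) (seAction d)
      (unitSphere d) (poisson d) (phi d m b ℓ J₁ Jₙ) where
  chaplygin := isChaplyginSystem_system hd hm hJ₁ hJₙ
  shape_space := isOrbitSpace_unitSphere hd b
  phi_smooth := contDiffOn_phi hm hJ₁ hJₙ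
  phi_simple Y Z hY hZ q hq := by
    have hγ := mapsTo_poisson hq
    refine (gyroscopicTensor_system hd hm hJ₁ hJₙ hY hZ hq).trans ?_
    have hφ := fun v hv =>
      (hasDirDerivWithin_phi (b := b) (ℓ := ℓ) hm hJ₁ hJₙ hγ (unitSphere d) v).fderivWithin_apply hv
    refine Eq.trans ?_ (congrArg₂ (fun s t : ℝ => s • Y (poisson d q) - t • Z (poisson d q))
      (hφ _ (hZ.tangent _ hγ)) (hφ _ (hY.tangent _ hγ))).symm
    simp only [smul_sub, smul_smul]

/-- Comparing one entry in each hypothesis gives `I₁ = J₁ + Jₙ` and `I₃ = 2 J₁`. Indices start at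
`0`, so `basisWedge 1 2` is `E₂ ∧ E₃`. -/
theorem phiThree_eq_phi {I₁ I₃ : ℝ}
    (h₁ : inertia 2 J₁ Jₙ (basisWedge 1 2) = I₁ • basisWedge 1 2)
    (h₃ : inertia 2 J₁ Jₙ (basisWedge 0 1) = I₃ • basisWedge 0 1) :
    phiThree m b ℓ I₁ I₃ = phi 2 m b ℓ J₁ Jₙ := by
  have h1 := congrFun (congrFun h₁ 1) 2
  have h3 := congrFun (congrFun h₃ 0) 1
  simp [inertia, massTensor, basisWedge, Fin.ext_iff] at h1 h3
  ext γ
  have hl : Fin.last 2 = 2 := rfl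
  rw [phiThree, phi, hl, ← h1, ← h3]
  congr 2
  ring

end RouthSphere

open RouthSphere in
theorem theorem4p2 (d : ℕ) (hd : 2 ≤ d) (m b ℓ grav J₁ Jₙ : ℝ)
    (hm : 0 < m) (hb : 0 < b) (hJ₁ : 0 < J₁) (hJₙ : 0 < Jₙ) :
    IsPhiSimpleChaplygin (system d m b ℓ grav J₁ Jₙ) d (specialEuclidean d) (seAction d)
      (unitSphere d) (poisson d) (phi d m b ℓ J₁ Jₙ) ∧
    -- the case `n = 3`, in terms of the moments of inertia about `E₁` and about the axis `E₃`
    ∀ I₁ I₃ : ℝ,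
      inertia 2 J₁ Jₙ (basisWedge 1 2) = I₁ • basisWedge 1 2 →
      inertia 2 J₁ Jₙ (basisWedge 0 1) = I₃ • basisWedge 0 1 →
      IsPhiSimpleChaplygin (system 2 m b ℓ grav J₁ Jₙ) 2 (specialEuclidean 2) (seAction 2)
        (unitSphere 2) (poisson 2) (phiThree m b ℓ I₁ I₃) := by
  refine ⟨isPhiSimpleChaplygin_system hd hm hJ₁ hJₙ, fun I₁ I₃ h₁ h₃ => ?_⟩
  rw [phiThree_eq_phi h₁ h₃]
  exact isPhiSimpleChaplygin_system le_rfl hm hJ₁ hJₙ
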